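/- **Setting.** Let $\widehat{\mathsf{PL}}_K=\prod_{n\ge 1}\mathsf{PL}_n$ be the completion of the free (right) pre-Lie algebra on one generator over a field $K\supseteq\mathbb{Q}$. Its elements are the formal series $A=\sum_T A_T\,T$ indexed by (non-planar) rooted trees $T$, graded by the number of vertices. For trees, $T\curvearrowleft T'$ is the sum, over the vertices $v$ of $T$, of the trees obtained by adding an edge from the root of $T'$ to $v$. Let $\bullet$ be the tree with one vertex and $\mathrm{Lnr}_\ell$ the linear tree with $\ell$ vertices. For a power series $f=\sum_k f_kx^k$ and $B\in\widehat{\mathsf{PL}}_K$, the element $f(B)$ of the completed enveloping algebra acts by $A\curvearrowleft f(B)=\sum_k f_k\,((A\curvearrowleft B)\cdots)\curvearrowleft B$ ($k$ factors $B$). For a series $A=\sum_n A_n$ with $A_n$ homogeneous of degree $n$, put $A[q]=\sum_n q^nA_n$. Let $\Omega\in\widehat{\mathsf{PL}}_{\mathbb{Q}}$ be the unique solution of $\bullet\curvearrowleft\frac{\Omega}{\exp(\Omega)-1}=\Omega$, and let $\Omega_q\in\widehat{\mathsf{PL}}_{\mathbb{Q}(q)}$ be the unique solution of $$\Omega_q[q]\curvearrowleft(\exp(\Omega)-1)+\Omega_q[q]-\Omega_q=\bullet\curvearrowleft\Omega_q+(q-1)\,\bullet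 .$$ Let $\widehat{\mathrm{Dend}}$ be the completed free dendriform algebra on one generator $Y$ over $\mathbb{Q}(q)$. Its elements are the formal series indexed by planar binary trees with at least one inner vertex, graded by the number of inner vertices. Its operations are $\prec$ and $\succ$, its associative product is $x*y=x\succ y+x\prec y$, and one adds a unit $1$, with $1\succ x=x=x\prec 1$. Let $\varphi:\widehat{\mathsf{PL}}_{\mathbb{Q}(q)}\to\widehat{\mathrm{Dend}}$ be the unique continuous linear map with $\varphi(\bullet)=Y$ and $\varphi(x\curvearrowleft y)=\varphi(y)\succ\varphi(x)-\varphi(x)\prec\varphi(y)$. Let $L=\sum_{n\ge1}L_n$ be the series of left combs, that is, the solution of $L=(1+L)\succ Y$ in $\widehat{\mathrm{Dend}}$, and let $\widetilde L=\sum_{n\ge1}(-1)^{n-1}L_n$ be its suspension. **Proposition.** The series $\Omega$, $\Omega_q$ and the map $\varphi$ above exist and are unique, the element $1-\widetilde L$ is invertible for $*$, and $X=\varphi(\Omega_q)$ is the unique solution in $\widehat{\mathrm{Dend}}$ of the equation $$X=(1-\widetilde L)^{-1}*X[q]*(1-\widetilde L)+(1-q)\sum_{\ell\ge1}(-1)^{\ell-1}\varphi(\mathrm{Lnr}_\ell).$$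 -/

import Mathlib

noncomputable section

open scoped PowerSeries

/-! ## Rooted trees and the completed free pre-Lie algebra on one generator -/

/-- Planar rooted trees: either the single vertex, or `attach t s`, the tree obtained from `t` by
adding `s` as a last branch on the root of `t` (a new edge joins the root of `s` to the root
of `t`). Every planar rooted tree is obtained in exactly one way. -/
inductive PlanarTree : Type
  | vertex : PlanarTree
  | attach : PlanarTree → PlanarTree → PlanarTree

namespace PlanarTree

/-- Number of vertices. -/
def size : PlanarTree → ℕ
  | vertex => 1
  | attach t s => t.size + s.size

/-- One elementary reordering: two consecutive branches on a vertex are exchanged. -/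
inductive Reorder : PlanarTree → PlanarTree → Prop
  | swap (t r s : PlanarTree) : Reorder ((t.attach r).attach s) ((t.attach s).attach r)
  | left {t t' : PlanarTree} (s : PlanarTree) : Reorder t t' → Reorder (t.attach s) (t'.attach s)
  | right (t : PlanarTree) {s s' : PlanarTree} : Reorder s s' → Reorder (t.attach s) (t.attach s')

theorem Reorder.size_eq {t t' : PlanarTree} (h : Reorder t t') : t.size = t'.size := by
  induction h with
  | swap t r s => simp only [size]; omega
  | left s _ ih => simp only [size, ih]
  | right t _ ih => simp only [size, ih]

theorem size_pos (t : PlanarTree) : 0 < t.size := by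
  induction t with
  | vertex => simp [size]
  | attach t s iht ihs => simp only [size]; omega

theorem finite_size_le (n : ℕ) : {t : PlanarTree | t.size ≤ n}.Finite := by
  induction n with
  | zero =>
    refine Set.Finite.subset Set.finite_empty ?_
    intro t ht
    have := size_pos t
    simp only [Set.mem_ofPred_eq] at ht
    omega
  | succ n ih =>
    refine Set.Finite.subset ((Set.finite_singleton vertex).union (Set.Finite.image2 attach ih ih)) ?_
    intro t ht
    cases t with
    | vertex => exact Or.inl rfl
    | attach t s =>
      have h1 := size_pos t
      have h2 := size_pos s
      simp only [Set.mem_ofPred_eq, size] at ht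
      exact Or.inr ⟨t, by simp only [Set.mem_ofPred_eq]; omega, s,
        by simp only [Set.mem_ofPred_eq]; omega, rfl⟩

end PlanarTree

/-- Rooted trees (not planar, not labelled): planar rooted trees up to the order of the branches
on each vertex. -/
def RTree : Type := Quot PlanarTree.Reorder

namespace RTree

/-- The rooted tree underlying a planar rooted tree. -/
def mk (t : PlanarTree) : RTree := Quot.mk _ t

theorem ind {p : RTree → Prop} (h : ∀ t, p (mk t)) (T : RTree) : p T := Quot.ind h T

theorem sound {t t' : PlanarTree} (h : PlanarTree.Reorder t t') : mk t = mk t' := Quot.sound h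

/-- The rooted tree with one vertex. -/
def vertex : RTree := mk PlanarTree.vertex

/-- `T.attach S`: the tree `T` with one more branch `S` on its root. -/
def attach : RTree → RTree → RTree :=
  Quot.map₂ PlanarTree.attach (fun t _ _ h => PlanarTree.Reorder.right t h)
    (fun _ _ s h => PlanarTree.Reorder.left s h)

theorem attach_attach (T R S : RTree) : (T.attach R).attach S = (T.attach S).attach R := by
  induction T using RTree.ind
  induction R using RTree.ind
  induction S using RTree.ind
  exact sound (PlanarTree.Reorder.swap _ _ _)

theorem attach_mk (t s : PlanarTree) : (mk t).attach (mk s) = mk (t.attach s) := rfl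

/-- Number of vertices. -/
def degree : RTree → ℕ := Quot.lift PlanarTree.size (fun _ _ h => h.size_eq)

theorem degree_attach (T S : RTree) : (T.attach S).degree = T.degree + S.degree := by
  induction T using RTree.ind
  induction S using RTree.ind
  rfl

theorem degree_pos (T : RTree) : 0 < T.degree := by
  induction T using RTree.ind
  exact PlanarTree.size_pos _

theorem finite_degree_le (n : ℕ) : {T : RTree | T.degree ≤ n}.Finite := by
  refine Set.Finite.subset ((PlanarTree.finite_size_le n).image mk) ?_
  intro T hT
  induction T using RTree.ind with
  | h t => exact ⟨t, hT, rfl⟩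

/-- `graftPlanar R t`: the multiset, indexed by the vertices of `t`, of the rooted trees obtained
by adding an edge from the root of `R` to a vertex of `t`. -/
def graftPlanar (R : RTree) : PlanarTree → Multiset RTree
  | PlanarTree.vertex => {vertex.attach R}
  | PlanarTree.attach t s =>
      (graftPlanar R t).map (fun U => U.attach (mk s)) +
        (graftPlanar R s).map (fun U => attach (mk t) U)

theorem graftPlanar_reorder (R : RTree) {t t' : PlanarTree} (h : PlanarTree.Reorder t t') :
    graftPlanar R t = graftPlanar R t' := by
  induction h with
  | swap t r s =>
    have h1 : ∀ U : RTree, (U.attach (mk r)).attach (mk s)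
        = (U.attach (mk s)).attach (mk r) := fun U => attach_attach _ _ _
    have h2 : ∀ U : RTree, (attach (mk t) U).attach (mk s)
        = attach (mk (t.attach s)) U := fun U => attach_attach _ _ _
    have h3 : ∀ U : RTree, (attach (mk t) U).attach (mk r)
        = attach (mk (t.attach r)) U := fun U => attach_attach _ _ _
    simp only [graftPlanar, Multiset.map_add, Multiset.map_map, Function.comp_def, h1, h2, h3]
    abel
  | @left t t' s h ih =>
    have : mk t = mk t' := sound h
    simp only [graftPlanar, ih, this]
  | @right t s s' h ih =>
    have : mk s = mk s' := sound h
    simp only [graftPlanar, ih, this]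

/-- `graft T R`: all rooted trees obtained from the disjoint union of `T` and `R` by adding an edge
from the root of `R` to one of the vertices of `T`, one for each vertex of `T`. -/
def graft (T R : RTree) : Multiset RTree :=
  Quot.lift (graftPlanar R) (fun _ _ h => graftPlanar_reorder R h) T

theorem graft_vertex (R : RTree) : graft vertex R = {vertex.attach R} := rfl

theorem graft_attach (T S R : RTree) :
    graft (T.attach S) R = (graft T R).map (fun U => U.attach S) +
      (graft S R).map (fun U => T.attach U) := by
  induction T using RTree.ind
  induction S using RTree.ind
  rfl

theorem degree_of_mem_graft {T R U : RTree} (h : U ∈ graft T R) :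
    U.degree = T.degree + R.degree := by
  induction T using RTree.ind with
  | h t =>
    induction t generalizing U with
    | vertex =>
      have : U = vertex.attach R := Multiset.mem_singleton.1 h
      rw [this, degree_attach]
      rfl
    | attach t s iht ihs =>
      have h' := h
      rw [← attach_mk,
        graft_attach, Multiset.mem_add, Multiset.mem_map, Multiset.mem_map] at h'
      rw [← attach_mk,
        degree_attach]
      rcases h' with ⟨V, hV, rfl⟩ | ⟨V, hV, rfl⟩
      · rw [degree_attach, iht hV]; omega
      · rw [degree_attach, ihs hV]; omega

/-- `linear n` is the linear tree with `n + 1` vertices. -/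
def linear : ℕ → RTree
  | 0 => vertex
  | n + 1 => vertex.attach (linear n)

end RTree

/-- The completion `∏ₙ PLₙ` of the free pre-Lie algebra `PL` on one generator over `K`: formal
series indexed by rooted trees, with coefficients in `K`. -/
abbrev PLHat (K : Type*) : Type _ := RTree → K

namespace PLHat

variable {K : Type*} [CommRing K]

open Classical in
/-- The series consisting of one rooted tree, with coefficient `1`. -/
def tree (T : RTree) : PLHat K := Pi.single T 1

open Classical in
/-- The pre-Lie product `A ↶ B`, extended from rooted trees to series: the coefficient of `T` is
the sum of `A(S) B(R)` times the number of vertices of `S` on which grafting `R` gives `T`. Only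
finitely many pairs `(S, R)` contribute. -/
def prelie (A B : PLHat K) : PLHat K := fun T =>
  ∑ᶠ p : RTree × RTree, A p.1 * B p.2 * ((RTree.graft p.1 p.2).count T : K)

open Classical in
theorem prelie_support_finite (A B : PLHat K) (T : RTree) :
    (Function.support fun p : RTree × RTree =>
      A p.1 * B p.2 * ((RTree.graft p.1 p.2).count T : K)).Finite := by
  refine Set.Finite.subset
    ((RTree.finite_degree_le T.degree).prod (RTree.finite_degree_le T.degree)) ?_
  rintro ⟨S, R⟩ h
  have hT : T ∈ RTree.graft S R := by
    by_contra hn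
    exact h (by simp [Multiset.count_eq_zero_of_notMem hn])
  have := RTree.degree_of_mem_graft hT
  exact ⟨by simp only [Set.mem_ofPred_eq]; omega, by simp only [Set.mem_ofPred_eq]; omega⟩

open Classical in
theorem prelie_tree (S R T : RTree) :
    prelie (tree S) (tree R) T = ((RTree.graft S R).count T : K) := by
  rw [prelie, finsum_eq_single _ (S, R)]
  · simp [tree]
  · rintro ⟨S', R'⟩ h
    by_cases hS : S' = S
    · have hR : R' ≠ R := fun e => h (by rw [hS, e])
      simp [tree, hR]
    · simp [tree, hS]

/-- `rightMul B k A = ((A ↶ B) ↶ ⋯ ) ↶ B` with `k` factors `B`. -/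
def rightMul (B : PLHat K) : ℕ → PLHat K → PLHat K
  | 0, A => A
  | k + 1, A => prelie (rightMul B k A) B

theorem rightMul_eq_zero (A B : PLHat K) {k : ℕ} {T : RTree} (h : T.degree ≤ k) :
    rightMul B k A T = 0 := by
  induction k generalizing T with
  | zero => have := T.degree_pos; omega
  | succ k ih =>
    classical
    refine (finsum_congr fun p => ?_).trans finsum_zero
    by_cases hT : T ∈ RTree.graft p.1 p.2
    · have h1 := RTree.degree_of_mem_graft hT
      have h2 := p.2.degree_pos
      rw [ih (by omega)]
      simp
    · simp [Multiset.count_eq_zero_of_notMem hT]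

/-- `act f A B` is `A ↶ f(B)`: the right action on the series `A` of the element
`f(B) = ∑ₖ fₖ B ⋆ ⋯ ⋆ B` of the completed enveloping algebra of the Lie algebra of `PL`, where `f`
is a formal power series in one variable. Since it is a right action that extends `↶`, the power
`B ⋆ ⋯ ⋆ B` acts by iterated right multiplication by `B`. Only finitely many `k` contribute to each
coefficient. -/
def act (f : K⟦X⟧) (A B : PLHat K) : PLHat K := fun T =>
  ∑ᶠ k : ℕ, PowerSeries.coeff k f * rightMul B k A T

theorem act_eq_sum (f : K⟦X⟧) (A B : PLHat K) (T : RTree) :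
    act f A B T = ∑ k ∈ Finset.range T.degree, PowerSeries.coeff k f * rightMul B k A T := by
  refine finsum_eq_sum_of_support_subset _ ?_
  intro k hk
  by_contra hn
  refine hk ?_
  simp only [Finset.coe_range, Set.mem_Iio, not_lt] at hn
  simp [rightMul_eq_zero A B hn]

/-- The `q`-shift `A[q] = ∑ₙ qⁿ Aₙ`. -/
def qShift (q : K) (A : PLHat K) : PLHat K := fun T => q ^ T.degree * A T

end PLHat

/-- The equation `• ↶ (Ω / (exp Ω - 1)) = Ω` for a series with rational coefficients, which defines
the classical series `Ω`. The power series `x / (exp x - 1)` is `∑ₖ (Bₖ / k!) xᵏ`. -/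
def IsOmega (Ω : PLHat ℚ) : Prop :=
  PLHat.act (bernoulliPowerSeries ℚ) (PLHat.tree RTree.vertex) Ω = Ω

/-- The indeterminate `q` of the field `ℚ(q)`. -/
abbrev qVar : RatFunc ℚ := RatFunc.X

/-- The equation `Ω_q[q] ↶ (exp Ω - 1) + Ω_q[q] - Ω_q = • ↶ Ω_q + (q - 1) •` for a series `Ω_q` with
coefficients in `ℚ(q)`, where `Ω` is a series with rational coefficients. -/
def IsOmegaQ (Ω : PLHat ℚ) (Ωq : PLHat (RatFunc ℚ)) : Prop :=
  PLHat.act (PowerSeries.exp (RatFunc ℚ) - 1) (PLHat.qShift qVar Ωq)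
      (fun T => algebraMap ℚ (RatFunc ℚ) (Ω T)) + PLHat.qShift qVar Ωq - Ωq
    = PLHat.prelie (PLHat.tree RTree.vertex) Ωq + (qVar - 1) • PLHat.tree RTree.vertex

/-! ## Planar binary trees and the completed free dendriform algebra on one generator -/

/-- Planar binary trees; the degree is the number `numNodes` of inner vertices. The tree `nil`
without inner vertex is the unit `1`. -/
abbrev PBTree : Type := BinaryTree Unit

/-- The completed free dendriform algebra on one generator, with a unit added: formal series indexed
by all planar binary trees, including the tree `nil` that stands for the unit. -/
def DendU (K : Type*) : Type _ := PBTree → K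

namespace DendU

open BinaryTree

variable {K : Type*} [CommRing K]

instance : AddCommGroup (DendU K) := inferInstanceAs (AddCommGroup (PBTree → K))

instance : Module K (DendU K) := inferInstanceAs (Module K (PBTree → K))

@[ext] theorem ext {f g : DendU K} (h : ∀ t, f t = g t) : f = g := funext h

@[simp] theorem add_apply (f g : DendU K) (t : PBTree) : (f + g) t = f t + g t := rfl
@[simp] theorem sub_apply (f g : DendU K) (t : PBTree) : (f - g) t = f t - g t := rfl
@[simp] theorem neg_apply (f : DendU K) (t : PBTree) : (-f) t = -f t := rfl
@[simp] theorem zero_apply (t : PBTree) : (0 : DendU K) t = 0 := rfl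
@[simp] theorem smul_apply (c : K) (f : DendU K) (t : PBTree) : (c • f) t = c * f t := rfl

/-- Coefficients of the associative product `f * g`. On trees the products of the free dendriform
algebra are `(a △ b) ≺ s = a △ (b * s)`, `t ≻ (a △ b) = (t * a) △ b`, and `t * s = t ≺ s + t ≻ s`
if `t` and `s` are not the unit `nil`. Hence the coefficient of `a △ b` in `f * g` is the sum of
the coefficient of `b` in `f(a △ ·) * g` (trees in `f ≺ g`) and of the coefficient of `a` in
`f * g(· △ b)` (trees in `f ≻ g`). -/
def mulCoeff : PBTree → (PBTree → K) → (PBTree → K) → K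
  | nil, f, g => f nil * g nil
  | node _ a b, f, g =>
      mulCoeff b (fun x => f (node () a x)) g + mulCoeff a f (fun x => g (node () x b))

/-- The dendriform product `f ≺ g` (meaningful if `f` has no constant term). -/
def prec (f g : DendU K) : DendU K
  | nil => 0
  | node _ a b => mulCoeff b (fun x => f (node () a x)) g

/-- The dendriform product `f ≻ g` (meaningful if `g` has no constant term). -/
def succ (f g : DendU K) : DendU K
  | nil => 0
  | node _ a b => mulCoeff a f (fun x => g (node () x b))

/-- The series consisting of one planar binary tree, with coefficient `1`. -/
def tree (t : PBTree) : DendU K := fun u => if u = t then 1 else 0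

instance : One (DendU K) := ⟨tree nil⟩

/-- The associative product. -/
instance : Mul (DendU K) := ⟨fun f g t => mulCoeff t f g⟩

theorem mul_apply (f g : DendU K) (t : PBTree) : (f * g) t = mulCoeff t f g := rfl

theorem mulCoeff_add_left (t : PBTree) (f f' g : PBTree → K) :
    mulCoeff t (fun x => f x + f' x) g = mulCoeff t f g + mulCoeff t f' g := by
  induction t generalizing f f' g with
  | nil => simp only [mulCoeff]; ring
  | node _ a b iha ihb => simp only [mulCoeff, iha, ihb]; ring

theorem mulCoeff_add_right (t : PBTree) (f g g' : PBTree → K) :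
    mulCoeff t f (fun x => g x + g' x) = mulCoeff t f g + mulCoeff t f g' := by
  induction t generalizing f g g' with
  | nil => simp only [mulCoeff]; ring
  | node _ a b iha ihb => simp only [mulCoeff, iha, ihb]; ring

theorem mulCoeff_smul_left (t : PBTree) (c : K) (f g : PBTree → K) :
    mulCoeff t (fun x => c * f x) g = c * mulCoeff t f g := by
  induction t generalizing f g with
  | nil => simp only [mulCoeff]; ring
  | node _ a b iha ihb => simp only [mulCoeff, iha, ihb]; ring

theorem mulCoeff_smul_right (t : PBTree) (c : K) (f g : PBTree → K) :
    mulCoeff t f (fun x => c * g x) = c * mulCoeff t f g := by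
  induction t generalizing f g with
  | nil => simp only [mulCoeff]; ring
  | node _ a b iha ihb => simp only [mulCoeff, iha, ihb]; ring

theorem mulCoeff_zero_left (t : PBTree) (g : PBTree → K) : mulCoeff t (fun _ => 0) g = 0 := by
  simpa using mulCoeff_smul_left t 0 (fun _ => 0) g

theorem mulCoeff_zero_right (t : PBTree) (f : PBTree → K) : mulCoeff t f (fun _ => 0) = 0 := by
  simpa using mulCoeff_smul_right t 0 f (fun _ => 0)

theorem mulCoeff_one_left (t : PBTree) (g : PBTree → K) :
    mulCoeff t (tree nil : DendU K) g = g t := by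
  induction t generalizing g with
  | nil => simp [mulCoeff, tree]
  | node _ a b iha _ =>
    have : (fun x => (tree nil : DendU K) (node () a x)) = fun _ => 0 := by
      funext x; simp [tree]
    simp only [mulCoeff, this, mulCoeff_zero_left, iha, zero_add]

theorem mulCoeff_one_right (t : PBTree) (f : PBTree → K) :
    mulCoeff t f (tree nil : DendU K) = f t := by
  induction t generalizing f with
  | nil => simp [mulCoeff, tree]
  | node _ a b _ ihb =>
    have : (fun x => (tree nil : DendU K) (node () x b)) = fun _ => 0 := by
      funext x; simp [tree]
    simp only [mulCoeff, this, mulCoeff_zero_right, ihb, add_zero]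

theorem mulCoeff_comm (b a : PBTree) (f h : PBTree → K) (G : PBTree → PBTree → K) :
    mulCoeff b (fun x => mulCoeff a f (fun y => G y x)) h
      = mulCoeff a f (fun y => mulCoeff b (G y) h) := by
  induction b generalizing h G with
  | nil =>
    have h1 := mulCoeff_smul_right a (h nil) f (fun y => G y nil)
    simp only [mulCoeff, mul_comm _ (h nil)]
    exact h1.symm
  | node _ c d ihc ihd =>
    simp only [mulCoeff, mulCoeff_add_right]
    rw [ihd h (fun y x => G y (node () c x)), ihc (fun x => h (node () x d)) G]

theorem mulCoeff_assoc (t : PBTree) (f g h : PBTree → K) :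
    mulCoeff t (fun x => mulCoeff x f g) h = mulCoeff t f (fun x => mulCoeff x g h) := by
  induction t generalizing f g h with
  | nil => simp only [mulCoeff]; ring
  | node _ a b iha ihb =>
    simp only [mulCoeff, mulCoeff_add_left, mulCoeff_add_right, iha, ihb]
    rw [mulCoeff_comm b a f h (fun y x => g (node () y x))]
    ring

/-- The completed free dendriform algebra with a unit added is an associative unital algebra. -/
instance : Ring (DendU K) where
  __ := (inferInstance : AddCommGroup (DendU K))
  left_distrib f g h := by ext t; exact mulCoeff_add_right t f g h
  right_distrib f g h := by ext t; exact mulCoeff_add_left t f g h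
  zero_mul g := by ext t; exact mulCoeff_zero_left t g
  mul_zero f := by ext t; exact mulCoeff_zero_right t f
  mul_assoc f g h := by ext t; exact mulCoeff_assoc t f g h
  one_mul g := by ext t; exact mulCoeff_one_left t g
  mul_one f := by ext t; exact mulCoeff_one_right t f

/-- The product is `f * g = f ≻ g + f ≺ g` on series without constant term. -/
theorem mul_eq_succ_add_prec (f g : DendU K) (hf : f nil = 0) :
    f * g = succ f g + prec f g := by
  ext t
  cases t with
  | nil => simp [mul_apply, mulCoeff, succ, prec, hf]
  | node _ a b => simp only [mul_apply, mulCoeff, succ, prec, add_apply]; ring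

/-- First dendriform axiom. -/
theorem prec_prec (x y z : DendU K) : prec (prec x y) z = prec x (y * z) := by
  ext t
  cases t with
  | nil => rfl
  | node _ a b => exact mulCoeff_assoc b (fun u => x (node () a u)) y z

/-- Second dendriform axiom. -/
theorem succ_prec (x y z : DendU K) : prec (succ x y) z = succ x (prec y z) := by
  ext t
  cases t with
  | nil => rfl
  | node _ a b => exact mulCoeff_comm b a x z (fun u v => y (node () u v))

/-- Third dendriform axiom. -/
theorem succ_succ (x y z : DendU K) : succ x (succ y z) = succ (x * y) z := by
  ext t
  cases t with
  | nil => rfl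
  | node _ a b => exact (mulCoeff_assoc a x y (fun u => z (node () u b))).symm

/-- `(a △ b) ≺ s = a △ (b * s)` on trees. -/
theorem prec_tree (a b s : PBTree) :
    (∀ u v, prec (tree (node () a b) : DendU K) (tree s) (node () u v)
      = if u = a then (tree b * tree s : DendU K) v else 0) := by
  intro u v
  by_cases h : u = a
  · subst h
    have : (fun x => (tree (node () u b) : DendU K) (node () u x)) = (tree b : DendU K) := by
      funext x; simp [tree]
    rw [if_pos rfl, mul_apply, ← this]
    rfl
  · simp only [prec, tree, node.injEq, h, false_and, and_false, if_false]
    exact mulCoeff_zero_left _ _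

/-- `t ≻ (a △ b) = (t * a) △ b` on trees. -/
theorem succ_tree (t a b : PBTree) :
    (∀ u v, succ (tree t : DendU K) (tree (node () a b)) (node () u v)
      = if v = b then (tree t * tree a : DendU K) u else 0) := by
  intro u v
  by_cases h : v = b
  · subst h
    have : (fun x => (tree (node () a v) : DendU K) (node () x v)) = (tree a : DendU K) := by
      funext x; simp [tree]
    rw [if_pos rfl, mul_apply, ← this]
    rfl
  · simp only [succ, tree, node.injEq, h, and_false, if_false]
    exact mulCoeff_zero_right _ _

/-- The generator of the free dendriform algebra: the planar binary tree with one inner vertex. -/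
def Y : DendU K := tree (node () nil nil)

/-- The left comb with `n` inner vertices. -/
def leftComb : ℕ → PBTree
  | 0 => nil
  | n + 1 => node () (leftComb n) nil

/-- The series `L = ∑_{n ≥ 1} Lₙ` of the left combs. -/
def L : DendU K := fun t => if t ≠ nil ∧ t = leftComb t.numNodes then 1 else 0

theorem succ_Y_node (f : DendU K) (a b : PBTree) :
    succ f Y (node () a b) = if b = nil then f a else 0 := by
  by_cases h : b = nil
  · subst h
    have : (fun x => (Y : DendU K) (node () x nil)) = (tree nil : DendU K) := by
      funext x; simp [Y, tree]
    simp only [succ, this, if_true]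
    exact mulCoeff_one_right a f
  · simp only [succ, Y, tree, node.injEq, h, and_false, if_false]
    exact mulCoeff_zero_right a f

/-- `L` solves `L = (1 + L) ≻ Y`, that is `L = Y + L ≻ Y`. -/
theorem L_eq : (L : DendU K) = succ (1 + L) Y := by
  have one_apply : ∀ t : PBTree, (1 : DendU K) t = if t = nil then 1 else 0 := fun _ => rfl
  ext t
  cases t with
  | nil => simp [L, succ]
  | node _ a b =>
    rw [succ_Y_node]
    by_cases h : b = nil
    · subst h
      cases a with
      | nil => simp [L, leftComb, one_apply]
      | node _ c d => simp [L, leftComb, one_apply]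
    · simp [L, leftComb, h]

/-- `L` is the only series without constant term that solves this equation. -/
theorem L_unique (f : DendU K) (h0 : f nil = 0) (h : f = succ (1 + f) Y) : f = L := by
  ext t
  induction t with
  | nil => simp [L, h0]
  | node _ a b iha _ =>
    rw [h, L_eq, succ_Y_node, succ_Y_node, add_apply, add_apply, iha]

/-- The `q`-shift `A[q] = ∑ₙ qⁿ Aₙ`. -/
def qShift (q : K) (A : DendU K) : DendU K := fun t => q ^ t.numNodes * A t

/-- The suspension `∑_{n ≥ 1} (-1)ⁿ⁻¹ Aₙ` of a series `A` without constant term; the sign is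
written `(-1)ⁿ⁺¹`. -/
def suspension (A : DendU K) : DendU K := fun t => (-1) ^ (t.numNodes + 1) * A t

end DendU

/-- The completed free dendriform algebra on one generator: series indexed by the planar binary
trees with at least one inner vertex, that is, without constant term. -/
def DendHat (K : Type*) [CommRing K] : Submodule K (DendU K) where
  carrier := {f | f BinaryTree.nil = 0}
  add_mem' := by
    intro f g hf hg
    simp only [Set.mem_ofPred_eq] at hf hg ⊢
    simp [hf, hg]
  zero_mem' := rfl
  smul_mem' := by
    intro c f hf
    simp only [Set.mem_ofPred_eq] at hf ⊢
    simp [hf]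

/-- `Φ` is the continuous extension to the completions of the morphism of pre-Lie algebras from `PL`
to `Dend` that sends the tree with one vertex to the generator `Y`, the pre-Lie product on
dendriform series being `x ↶ y = y ≻ x - x ≺ y`. Continuity refers to the topologies defined by the
degree. -/
structure IsPhi {K : Type*} [CommRing K] (Φ : PLHat K →ₗ[K] DendHat K) : Prop where
  map_vertex : (Φ (PLHat.tree RTree.vertex) : DendU K) = DendU.Y
  map_prelie : ∀ A B : PLHat K, (Φ (PLHat.prelie A B) : DendU K) =
    DendU.succ (Φ B : DendU K) (Φ A) - DendU.prec (Φ A : DendU K) (Φ B)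
  continuous : ∀ m : ℕ, ∃ n : ℕ, ∀ A : PLHat K, (∀ T : RTree, T.degree ≤ n → A T = 0) →
    ∀ t : PBTree, t.numNodes ≤ m → (Φ A : DendU K) t = 0

/-- The series `∑_{ℓ ≥ 1} (-1)^{ℓ-1} Φ(Lnr_ℓ)`, where `Lnr_ℓ` is the linear tree with `ℓ` vertices
(`ℓ = k + 1` below). For `Φ` as above each coefficient is a finite sum, as `Φ(Lnr_ℓ)` is homogeneous
of degree `ℓ`. -/
def altLinearImage {K : Type*} [CommRing K] (Φ : PLHat K →ₗ[K] DendHat K) : DendU K := fun t =>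
  ∑ᶠ k : ℕ, (-1) ^ k * (Φ (PLHat.tree (RTree.linear k)) : DendU K) t

end

/-! The map `φ` is given on trees by a symmetric brace. A tree whose branches have images `x₁, …,
xₙ` goes to `Y{x₁, …, xₙ}`, the sum over all splittings of the `xᵢ` into two parts of `P △ Q`, where
`P` sums the products `x ≺ (x' ≺ ⋯)` over the orders of the first part and `Q` sums, with sign, the
products `(⋯ ≻ x) ≻ x'` over those of the second. The recursion `Y{s} ↶ a = Y{a, s} + ∑ Y{…, x ↶ a,
…}` (`brace_cons_add`) mirrors what grafting does to the branches of a tree, so `φ` is a morphism.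
It is unique because grafting `S` on `T` yields `T.attach S` and trees with fewer branches on the
root (`graft_induction`).

Put `ω = φ(Ω)`, `F = exp ω` and `D = (· ↶ ω)`. The operators `ω ≻ ·` and `· ≺ ω` commute and their
difference is `D`, so `exp D` is the conjugation `a ↦ F ≻ a ≺ F⁻¹` (`prec_exp_eq`). The equation of
`Ω` says that `D / (exp D - 1)` sends `Y` to `ω`. Inverting this series gives `Y ≺ F = F - 1`
(`Y_prec_exp_eq`). Since `u = 1 - L̃` satisfies `u ≻ Y = 1 - u`, the dendriform axioms make `F` and
`u` mutually inverse.

Finally `W = F * Z * u` satisfies `W + Y ↶ W = F ≻ Z ≺ u` (`conj_add_prelieₗ_Y`). For `x = φ(Ω_q)`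
and `Z = x[q]` the right side is the image of `Ω_q[q] ↶ exp Ω`, which the equation of `Ω_q` turns
into `x + Y ↶ x + (q - 1) Y`. The alternating series `Λ` of linear trees satisfies `Λ + Y ↶ Λ = Y`.
As `z ↦ z + Y ↶ z` is injective on series without constant term, `x = W + (1 - q) Λ`. Two solutions
differ by some `d = F * d[q] * u`, whose lowest term would satisfy `dₙ = qⁿ dₙ`, so `d = 0`. -/

noncomputable section

open scoped PowerSeries Nat

/-! ### Sums over a marked element of a multiset and over splittings -/

namespace Multiset

open Classical in
/-- The sum of `g x (s - {x})` over the elements `x` of a multiset `s`. -/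
def sumErase {α M : Type*} [AddCommMonoid M] (g : α → Multiset α → M) (s : Multiset α) : M :=
  (s.map fun x => g x (s.erase x)).sum

section SumErase

variable {α M M' : Type*} [AddCommMonoid M] [AddCommMonoid M']

@[simp] theorem sumErase_zero (g : α → Multiset α → M) : sumErase g 0 = 0 := rfl

@[simp] theorem sumErase_cons (g : α → Multiset α → M) (a : α) (s : Multiset α) :
    sumErase g (a ::ₘ s) = g a s + sumErase (fun x r => g x (a ::ₘ r)) s := by
  classical
  simp only [sumErase, map_cons, sum_cons, erase_cons_head]
  congr 2
  refine map_congr rfl fun x hx => ?_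
  rw [erase_cons_tail_of_mem hx]

theorem sumErase_congr {g h : α → Multiset α → M} {s : Multiset α}
    (H : ∀ x r, s = x ::ₘ r → g x r = h x r) : sumErase g s = sumErase h s := by
  classical
  simp only [sumErase]
  congr 1
  exact map_congr rfl fun x hx => H x _ (cons_erase hx).symm

theorem sumErase_add (g h : α → Multiset α → M) (s : Multiset α) :
    sumErase (fun x r => g x r + h x r) s = sumErase g s + sumErase h s :=
  sum_map_add

theorem map_sumErase (ψ : M →+ M') (g : α → Multiset α → M) (s : Multiset α) :
    ψ (sumErase g s) = sumErase (fun x r => ψ (g x r)) s := by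
  simp only [sumErase, map_multiset_sum, map_map, Function.comp_def]

/-- Both sides run over the ordered pairs of distinct positions in `s`. -/
theorem sumErase_comm (h : α → α → Multiset α → M) (s : Multiset α) :
    sumErase (fun x => sumErase (h x)) s = sumErase (fun y => sumErase fun x => h x y) s := by
  induction s using Multiset.induction generalizing h with
  | empty => rfl
  | cons a s ih =>
    simp only [sumErase_cons, sumErase_add, ih (fun x y r => h x y (a ::ₘ r))]
    abel

theorem sum_antidiagonal_cons (G : Multiset α → Multiset α → M) (a : α) (s : Multiset α) :
    ((antidiagonal (a ::ₘ s)).map fun p => G p.1 p.2).sum =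
      ((antidiagonal s).map fun p => G p.1 (a ::ₘ p.2)).sum +
        ((antidiagonal s).map fun p => G (a ::ₘ p.1) p.2).sum := by
  simp [antidiagonal_cons, map_map]

/-- Splitting `s` and then marking an element of the first part amounts to marking an element and
then splitting the rest. -/
theorem sum_antidiagonal_sumErase_left (G : α → Multiset α → Multiset α → M) (s : Multiset α) :
    ((antidiagonal s).map fun p => sumErase (fun x r => G x r p.2) p.1).sum =
      sumErase (fun x r => ((antidiagonal r).map fun p => G x p.1 p.2).sum) s := by
  induction s using Multiset.induction generalizing G with
  | empty => simp
  | cons a s ih =>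
    rw [sum_antidiagonal_cons fun A B => sumErase (fun x r => G x r B) A]
    simp only [sumErase_cons, sum_antidiagonal_cons (G _), sumErase_add, sum_map_add]
    rw [ih fun x A B => G x A (a ::ₘ B), ih fun x A B => G x (a ::ₘ A) B]
    abel

theorem sum_antidiagonal_sumErase_right (G : α → Multiset α → Multiset α → M) (s : Multiset α) :
    ((antidiagonal s).map fun p => sumErase (fun x r => G x p.1 r) p.2).sum =
      sumErase (fun x r => ((antidiagonal r).map fun p => G x p.1 p.2).sum) s := by
  induction s using Multiset.induction generalizing G with
  | empty => simp
  | cons a s ih =>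
    rw [sum_antidiagonal_cons fun A B => sumErase (fun x r => G x A r) B]
    simp only [sumErase_cons, sum_antidiagonal_cons (G _), sumErase_add, sum_map_add]
    rw [ih fun x A B => G x A (a ::ₘ B), ih fun x A B => G x (a ::ₘ A) B]
    abel

end SumErase

end Multiset

/-! ### Bilinear dendriform operations and the symmetric brace of `Y` -/

namespace DendU

open BinaryTree Multiset

variable {K : Type*} [CommRing K]

/-- The operation `≺` as a bilinear map. -/
def precₗ : DendU K →ₗ[K] DendU K →ₗ[K] DendU K :=
  LinearMap.mk₂ K prec
    (fun f f' g => by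
      ext t; cases t with
      | nil => simp [prec]
      | node _ a b => exact mulCoeff_add_left b _ _ _)
    (fun c f g => by
      ext t; cases t with
      | nil => simp [prec]
      | node _ a b => exact mulCoeff_smul_left b _ _ _)
    (fun f g g' => by
      ext t; cases t with
      | nil => simp [prec]
      | node _ a b => exact mulCoeff_add_right b _ _ _)
    (fun c f g => by
      ext t; cases t with
      | nil => simp [prec]
      | node _ a b => exact mulCoeff_smul_right b _ _ _)

/-- The operation `≻` as a bilinear map. -/
def succₗ : DendU K →ₗ[K] DendU K →ₗ[K] DendU K :=
  LinearMap.mk₂ K succ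
    (fun f f' g => by
      ext t; cases t with
      | nil => simp [succ]
      | node _ a b => exact mulCoeff_add_left a _ _ _)
    (fun c f g => by
      ext t; cases t with
      | nil => simp [succ]
      | node _ a b => exact mulCoeff_smul_left a _ _ _)
    (fun f g g' => by
      ext t; cases t with
      | nil => simp [succ]
      | node _ a b => exact mulCoeff_add_right a _ _ _)
    (fun c f g => by
      ext t; cases t with
      | nil => simp [succ]
      | node _ a b => exact mulCoeff_smul_right a _ _ _)

/-- `a △ b`, extended bilinearly from trees to series. -/
def join (f g : DendU K) : DendU K
  | nil => 0
  | node _ a b => f a * g b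

/-- The operation `△` as a bilinear map. -/
def joinₗ : DendU K →ₗ[K] DendU K →ₗ[K] DendU K :=
  LinearMap.mk₂ K join
    (fun f f' g => by
      ext t; cases t with
      | nil => simp [join]
      | node _ a b => exact add_mul _ _ _)
    (fun c f g => by
      ext t; cases t with
      | nil => simp [join]
      | node _ a b => exact mul_assoc _ _ _)
    (fun f g g' => by
      ext t; cases t with
      | nil => simp [join]
      | node _ a b => exact mul_add _ _ _)
    (fun c f g => by
      ext t; cases t with
      | nil => simp [join]
      | node _ a b => exact mul_left_comm _ _ _)

theorem precₗ_apply (f g : DendU K) : precₗ f g = prec f g := rfl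
theorem succₗ_apply (f g : DendU K) : succₗ f g = succ f g := rfl
theorem joinₗ_apply (f g : DendU K) : joinₗ f g = join f g := rfl

@[simp] theorem prec_nil (f g : DendU K) : prec f g nil = 0 := rfl
@[simp] theorem succ_nil (f g : DendU K) : succ f g nil = 0 := rfl
@[simp] theorem join_nil (f g : DendU K) : join f g nil = 0 := rfl

theorem prec_add (f g h : DendU K) : prec f (g + h) = prec f g + prec f h := (precₗ f).map_add g h
theorem prec_sub (f g h : DendU K) : prec f (g - h) = prec f g - prec f h := (precₗ f).map_sub g h
theorem add_prec (f g h : DendU K) : prec (f + g) h = prec f h + prec g h := precₗ.map_add₂ f g h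
theorem succ_add (f g h : DendU K) : succ f (g + h) = succ f g + succ f h := (succₗ f).map_add g h
theorem succ_sub (f g h : DendU K) : succ f (g - h) = succ f g - succ f h := (succₗ f).map_sub g h
theorem add_succ (f g h : DendU K) : succ (f + g) h = succ f h + succ g h := succₗ.map_add₂ f g h
theorem sub_succ (f g h : DendU K) : succ (f - g) h = succ f h - succ g h := succₗ.map_sub₂ f g h
theorem neg_prec (f g : DendU K) : prec (-f) g = -prec f g := precₗ.map_neg₂ f g
theorem neg_succ (f g : DendU K) : succ (-f) g = -succ f g := succₗ.map_neg₂ f g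

theorem prec_one {f : DendU K} (hf : f nil = 0) : prec f 1 = f := by
  ext t
  cases t with
  | nil => exact hf.symm
  | node _ a b => exact mulCoeff_one_right b _

theorem one_succ {f : DendU K} (hf : f nil = 0) : succ 1 f = f := by
  ext t
  cases t with
  | nil => exact hf.symm
  | node _ a b => exact mulCoeff_one_left a _

/-- The formula only fails at `nil`, where the product has the coefficient `f nil * g nil`. This
variant allows a left factor with constant term, such as `F` or `u`. -/
theorem mul_eq_succ_add_prec' (f g : DendU K) (hg : g nil = 0) :
    f * g = succ f g + prec f g := by
  ext t
  cases t with
  | nil => simp [mul_apply, mulCoeff, hg]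
  | node _ a b => simp only [mul_apply, mulCoeff, succ, prec, add_apply]; ring

theorem succ_join (s f g : DendU K) : succ s (join f g) = join (s * f) g := by
  ext t
  cases t with
  | nil => rfl
  | node _ a b =>
    simp only [succ, join, mul_comm _ (g b)]
    exact mulCoeff_smul_right a (g b) s f

theorem join_prec (f g s : DendU K) : prec (join f g) s = join f (g * s) := by
  ext t
  cases t with
  | nil => rfl
  | node _ a b => exact mulCoeff_smul_left b (f a) g s

/-- The pre-Lie product `x ↶ y = y ≻ x - x ≺ y` as a bilinear map. -/
def prelieₗ : DendU K →ₗ[K] DendU K →ₗ[K] DendU K := succₗ.flip - precₗ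

theorem prelieₗ_apply (x y : DendU K) : prelieₗ x y = succ y x - prec x y := rfl

/-- Sum over the `n!` orders of a multiset with `n` elements of the products
`x₁ ≺ (x₂ ≺ (⋯ ≺ xₙ))`; the first argument is the number of elements. -/
def rightProdAux : ℕ → Multiset (DendU K) → DendU K
  | 0, _ => 1
  | n + 1, s => sumErase (fun x r => prec x (rightProdAux n r)) s

/-- Sum over all orders of a multiset of the products `x₁ ≺ (x₂ ≺ (⋯ ≺ xₙ))`. -/
def rightProd (s : Multiset (DendU K)) : DendU K := rightProdAux (card s) s

@[simp] theorem rightProd_zero : rightProd (0 : Multiset (DendU K)) = 1 := rfl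

/-- The recursion freed from the counter, which only makes it structural. At `s = 0` it would give
the empty sum instead of `1`. -/
theorem rightProd_eq {s : Multiset (DendU K)} (hs : s ≠ 0) :
    rightProd s = sumErase (fun x r => prec x (rightProd r)) s := by
  obtain ⟨n, hn⟩ := Nat.exists_eq_succ_of_ne_zero (mt card_eq_zero.1 hs)
  rw [rightProd, hn]
  refine sumErase_congr fun x r h => ?_
  rw [h, card_cons] at hn
  rw [rightProd, Nat.succ.inj hn]

theorem rightProd_cons (a : DendU K) (s : Multiset (DendU K)) :
    rightProd (a ::ₘ s) =
      prec a (rightProd s) + sumErase (fun x r => prec x (rightProd (a ::ₘ r))) s := by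
  rw [rightProd_eq (cons_ne_zero), sumErase_cons]

/-- `(-1)ⁿ` times the sum over the `n!` orders of a multiset with `n` elements of the products
`((x₁ ≻ x₂) ≻ ⋯) ≻ xₙ`; the first argument is the number of elements. -/
def leftProdAux : ℕ → Multiset (DendU K) → DendU K
  | 0, _ => 1
  | n + 1, s => -sumErase (fun x r => succ (leftProdAux n r) x) s

/-- Signed sum over all orders of a multiset of the products `((x₁ ≻ x₂) ≻ ⋯) ≻ xₙ`. -/
def leftProd (s : Multiset (DendU K)) : DendU K := leftProdAux (card s) s

@[simp] theorem leftProd_zero : leftProd (0 : Multiset (DendU K)) = 1 := rfl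

theorem leftProd_eq {s : Multiset (DendU K)} (hs : s ≠ 0) :
    leftProd s = -sumErase (fun x r => succ (leftProd r) x) s := by
  obtain ⟨n, hn⟩ := Nat.exists_eq_succ_of_ne_zero (mt card_eq_zero.1 hs)
  rw [leftProd, hn]
  refine congrArg Neg.neg (sumErase_congr fun x r h => ?_)
  rw [h, card_cons] at hn
  rw [leftProd, Nat.succ.inj hn]

theorem leftProd_cons (a : DendU K) (s : Multiset (DendU K)) :
    leftProd (a ::ₘ s) =
      -(succ (leftProd s) a + sumErase (fun x r => succ (leftProd (a ::ₘ r)) x) s) := by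
  rw [leftProd_eq (cons_ne_zero), sumErase_cons]

/-- A function of a multiset that is additive in each element. -/
def Multiadditive (h : Multiset (DendU K) → DendU K) : Prop :=
  ∀ (x y : DendU K) (s : Multiset (DendU K)), h ((x + y) ::ₘ s) = h (x ::ₘ s) + h (y ::ₘ s)

namespace Multiadditive

variable {h : Multiset (DendU K) → DendU K}

theorem cons (hh : Multiadditive h) (a : DendU K) : Multiadditive fun s => h (a ::ₘ s) := by
  intro x y s
  simp only [cons_swap a]
  exact hh x y _

theorem map_zero (hh : Multiadditive h) (s : Multiset (DendU K)) : h (0 ::ₘ s) = 0 := by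
  simpa using hh 0 0 s

theorem map_sum (hh : Multiadditive h) (w s : Multiset (DendU K)) :
    h (w.sum ::ₘ s) = (w.map fun x => h (x ::ₘ s)).sum := by
  induction w using Multiset.induction with
  | empty => simpa using hh.map_zero s
  | cons a w ih => rw [sum_cons, hh, ih, map_cons, sum_cons]

end Multiadditive

theorem multiadditive_rightProd : Multiadditive (rightProd (K := K)) := by
  intro x y s
  induction s using Multiset.strongInductionOn with
  | ih s ih =>
    rw [rightProd_cons (x + y), rightProd_cons x, rightProd_cons y, add_prec]
    rw [show sumErase (fun z r => prec z (rightProd ((x + y) ::ₘ r))) s =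
      sumErase (fun z r => prec z (rightProd (x ::ₘ r)) + prec z (rightProd (y ::ₘ r))) s from
        sumErase_congr fun z r e => by rw [ih r (e ▸ lt_cons_self r z), prec_add], sumErase_add]
    abel

theorem multiadditive_leftProd : Multiadditive (leftProd (K := K)) := by
  intro x y s
  induction s using Multiset.strongInductionOn with
  | ih s ih =>
    rw [leftProd_cons (x + y), leftProd_cons x, leftProd_cons y, succ_add]
    rw [show sumErase (fun z r => succ (leftProd ((x + y) ::ₘ r)) z) s =
      sumErase (fun z r => succ (leftProd (x ::ₘ r)) z + succ (leftProd (y ::ₘ r)) z) s from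
        sumErase_congr fun z r e => by rw [ih r (e ▸ lt_cons_self r z), add_succ], sumErase_add]
    abel

/-- Left multiplication by `a` inserts `a` at every place. Indeed `a * (x ≺ w) = a ≺ (x ≺ w) + (a ≻
x) ≺ w`, where `a ≻ x = x ↶ a + x ≺ a`; the first summand is a correction term, and the second gives
`x ≺ (a * w)`, to which induction applies. -/
theorem rightProd_cons_add {a : DendU K} (ha : a nil = 0) (s : Multiset (DendU K)) :
    rightProd (a ::ₘ s) + sumErase (fun x r => rightProd (prelieₗ x a ::ₘ r)) s =
      a * rightProd s := by
  induction s using Multiset.strongInductionOn with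
  | ih s ih =>
    by_cases hs : s = 0
    · subst hs
      rw [rightProd_cons, sumErase_zero, sumErase_zero, rightProd_zero, prec_one ha, mul_one,
        add_zero, add_zero]
    rw [show (fun x r => rightProd (prelieₗ x a ::ₘ r)) = fun x r =>
        prec (prelieₗ x a) (rightProd r) +
          sumErase (fun y t => prec y (rightProd (prelieₗ x a ::ₘ t))) r from
      funext fun x => funext fun r => rightProd_cons _ _, rightProd_cons, sumErase_add,
      sumErase_comm fun x y r => prec y (rightProd (prelieₗ x a ::ₘ r))]
    have h1 : sumErase (fun x r => prec x (rightProd (a ::ₘ r))) s +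
        sumErase (fun y => sumErase fun x r => prec y (rightProd (prelieₗ x a ::ₘ r))) s =
        sumErase (fun x r => prec (prec x a) (rightProd r)) s := by
      rw [← sumErase_add]
      refine sumErase_congr fun x r e => ?_
      rw [prec_prec, ← ih r (e ▸ lt_cons_self r x), prec_add]
      congr 1
      exact (map_sumErase (precₗ x).toAddMonoidHom _ _).symm
    have h2 : sumErase (fun x r => prec (prelieₗ x a) (rightProd r)) s +
        sumErase (fun x r => prec (prec x a) (rightProd r)) s =
        succ a (sumErase (fun x r => prec x (rightProd r)) s) := by
      rw [← sumErase_add]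
      refine Eq.trans ?_ (map_sumErase (succₗ a).toAddMonoidHom _ _).symm
      refine sumErase_congr fun x r _ => ?_
      rw [← add_prec, prelieₗ_apply, sub_add_cancel, succ_prec]
      rfl
    rw [← rightProd_eq hs] at h2
    rw [mul_eq_succ_add_prec _ _ ha]
    linear_combination (norm := abel) h1 + h2

/-- Mirror image of `rightProd_cons_add`: `(w ≻ x) * a = (w ≻ x) ≻ a + w ≻ (x ≺ a)` with `x ≺ a = a
≻ x - x ↶ a` and `w ≻ (a ≻ x) = (w * a) ≻ x`. The minus sign of `x ↶ a` is the reason for the signs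
in `leftProd`. -/
theorem leftProd_cons_add {a : DendU K} (ha : a nil = 0) (s : Multiset (DendU K)) :
    leftProd (a ::ₘ s) + sumErase (fun x r => leftProd (prelieₗ x a ::ₘ r)) s =
      -(leftProd s * a) := by
  induction s using Multiset.strongInductionOn with
  | ih s ih =>
    by_cases hs : s = 0
    · subst hs
      rw [leftProd_cons, sumErase_zero, sumErase_zero, leftProd_zero, one_succ ha, one_mul,
        add_zero, add_zero]
    rw [show (fun x r => leftProd (prelieₗ x a ::ₘ r)) = fun x r =>
        (-succₗ (leftProd r)) (prelieₗ x a) +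
          -sumErase (fun y t => succ (leftProd (prelieₗ x a ::ₘ t)) y) r from
      funext fun x => funext fun r => by
        rw [leftProd_cons, neg_add]; rfl, leftProd_cons, sumErase_add]
    have h0 : sumErase (fun x r =>
          -sumErase (fun y t => succ (leftProd (prelieₗ x a ::ₘ t)) y) r) s =
        -sumErase (fun y => sumErase fun x r => succ (leftProd (prelieₗ x a ::ₘ r)) y) s := by
      rw [← sumErase_comm]
      exact (map_sumErase (-AddMonoidHom.id (DendU K)) _ _).symm
    have h1 : sumErase (fun x r => succ (leftProd (a ::ₘ r)) x) s +
        sumErase (fun y => sumErase fun x r => succ (leftProd (prelieₗ x a ::ₘ r)) y) s =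
        sumErase (fun x r => -succₗ (leftProd r) (succ a x)) s := by
      rw [← sumErase_add]
      refine sumErase_congr fun x r e => ?_
      rw [succₗ_apply, succ_succ, ← neg_succ, ← ih r (e ▸ lt_cons_self r x), add_succ]
      congr 1
      exact (map_sumErase (succₗ.flip x).toAddMonoidHom _ _).symm
    have h2 : sumErase (fun x r => (-succₗ (leftProd r)) (prelieₗ x a)) s -
        sumErase (fun x r => -succₗ (leftProd r) (succ a x)) s =
        prec (sumErase (fun x r => succ (leftProd r) x) s) a := by
      rw [sub_eq_iff_eq_add]
      refine Eq.trans ?_ (congrArg (· + _) (map_sumErase (precₗ.flip a).toAddMonoidHom _ _).symm)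
      rw [← sumErase_add]
      refine sumErase_congr fun x r _ => ?_
      simp only [LinearMap.neg_apply, prelieₗ_apply, map_sub]
      change _ = prec (succ (leftProd r) x) a + _
      rw [succ_prec, succₗ_apply, succₗ_apply]
      abel
    rw [← neg_eq_iff_eq_neg.2 (leftProd_eq hs), neg_prec] at h2
    rw [h0, mul_eq_succ_add_prec' _ _ ha]
    linear_combination (norm := abel) h2 - h1

/-- The symmetric brace `Y{x₁, …, xₙ}`. -/
def brace (s : Multiset (DendU K)) : DendU K :=
  ((antidiagonal s).map fun p => join (rightProd p.1) (leftProd p.2)).sum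

theorem brace_zero : brace (0 : Multiset (DendU K)) = Y := by
  ext t
  cases t with
  | nil => simp [brace, Y, tree]
  | node _ a b =>
    by_cases ha : a = nil <;> by_cases hb : b = nil <;>
      simp [brace, Y, tree, join, ha, hb, show (1 : DendU K) = tree nil from rfl]

@[simp] theorem brace_nil (s : Multiset (DendU K)) : brace s nil = 0 := by
  refine Multiset.sum_induction (fun f : DendU K => f nil = 0) _ (fun f g hf hg => ?_) rfl ?_
  · simp [hf, hg]
  · intro f hf
    obtain ⟨p, -, rfl⟩ := mem_map.1 hf
    rfl

theorem brace_cons (a : DendU K) (s : Multiset (DendU K)) :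
    brace (a ::ₘ s) =
      ((antidiagonal s).map fun p => join (rightProd p.1) (leftProd (a ::ₘ p.2))).sum +
        ((antidiagonal s).map fun p => join (rightProd (a ::ₘ p.1)) (leftProd p.2)).sum :=
  sum_antidiagonal_cons (fun A B => join (rightProd A) (leftProd B)) a s

theorem multiadditive_brace : Multiadditive (brace (K := K)) := by
  intro x y s
  simp only [brace_cons, multiadditive_rightProd x y, multiadditive_leftProd x y,
    ← joinₗ_apply, _root_.map_add, LinearMap.add_apply, sum_map_add]
  abel

/-- Inserting `a` in the part left of `△` multiplies that part by `a` on the left, which gives `a ≻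
brace s`. Inserting it in the right part gives `-(brace s ≺ a)`. -/
theorem brace_cons_add {a : DendU K} (ha : a nil = 0) (s : Multiset (DendU K)) :
    brace (a ::ₘ s) + sumErase (fun x r => brace (prelieₗ x a ::ₘ r)) s =
      prelieₗ (brace s) a := by
  simp only [brace_cons, sumErase_add]
  rw [← sum_antidiagonal_sumErase_right fun x A B =>
      join (rightProd A) (leftProd (prelieₗ x a ::ₘ B)),
    ← sum_antidiagonal_sumErase_left fun x A B =>
      join (rightProd (prelieₗ x a ::ₘ A)) (leftProd B), add_add_add_comm, ← sum_map_add,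
    ← sum_map_add]
  have h1 : ∀ p : Multiset (DendU K) × Multiset (DendU K),
      join (rightProd p.1) (leftProd (a ::ₘ p.2)) +
        sumErase (fun x r => join (rightProd p.1) (leftProd (prelieₗ x a ::ₘ r))) p.2 =
      -precₗ.flip a (join (rightProd p.1) (leftProd p.2)) := fun p => by
    refine (congrArg (_ + ·) (map_sumErase (joinₗ (rightProd p.1)).toAddMonoidHom _ _).symm).trans
      ?_
    change joinₗ _ _ + joinₗ _ _ = _
    rw [← _root_.map_add, leftProd_cons_add ha, map_neg]
    exact congrArg _ (join_prec _ _ _).symm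
  have h2 : ∀ p : Multiset (DendU K) × Multiset (DendU K),
      join (rightProd (a ::ₘ p.1)) (leftProd p.2) +
        sumErase (fun x r => join (rightProd (prelieₗ x a ::ₘ r)) (leftProd p.2)) p.1 =
      succₗ a (join (rightProd p.1) (leftProd p.2)) := fun p => by
    refine (congrArg (_ + ·)
      (map_sumErase (joinₗ.flip (leftProd p.2)).toAddMonoidHom _ _).symm).trans ?_
    change joinₗ.flip _ _ + joinₗ.flip _ _ = _
    rw [← _root_.map_add, rightProd_cons_add ha]
    exact (succ_join _ _ _).symm
  rw [map_congr rfl fun p _ => h1 p, map_congr rfl fun p _ => h2 p, prelieₗ_apply, sub_eq_neg_add,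
    sum_map_neg, brace, ← succₗ_apply, ← precₗ_apply, ← LinearMap.flip_apply precₗ,
    map_multiset_sum, map_multiset_sum, map_map, map_map]
  rfl

end DendU

/-! ### Root valency and induction by grafting -/

namespace PlanarTree

/-- Number of branches on the root. -/
def valency : PlanarTree → ℕ
  | vertex => 0
  | attach t _ => t.valency + 1

theorem Reorder.valency_eq {t t' : PlanarTree} (h : Reorder t t') : t.valency = t'.valency := by
  induction h with
  | swap t r s => rfl
  | left s _ ih => simp only [valency, ih]
  | right t _ ih => rfl

end PlanarTree

namespace RTree

/-- Number of branches on the root. -/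
def valency : RTree → ℕ := Quot.lift PlanarTree.valency fun _ _ h => h.valency_eq

theorem valency_attach (T S : RTree) : (T.attach S).valency = T.valency + 1 := by
  induction T using RTree.ind
  induction S using RTree.ind
  rfl

/-- Induction along the construction of rooted trees by adding branches to a root. -/
theorem attach_induction {p : RTree → Prop} (vertex : p vertex)
    (attach : ∀ T S, p T → p S → p (T.attach S)) (T : RTree) : p T := by
  induction T using RTree.ind with
  | h t =>
    induction t with
    | vertex => exact vertex
    | attach t s iht ihs => exact attach _ _ iht ihs

/-- Among the trees obtained by grafting `S` on `T`, all but `T.attach S` have as many branches on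
the root as `T`. -/
theorem exists_graft_eq_cons (T S : RTree) :
    ∃ W, graft T S = T.attach S ::ₘ W ∧ ∀ U ∈ W, U.valency = T.valency := by
  induction T using attach_induction with
  | vertex => exact ⟨0, rfl, by simp⟩
  | attach T R ih _ =>
    obtain ⟨W, hW, hv⟩ := ih
    refine ⟨W.map (fun U => U.attach R) + (graft R S).map (fun U => T.attach U), ?_, ?_⟩
    · rw [graft_attach, hW, Multiset.map_cons, Multiset.cons_add, attach_attach]
    · intro U hU
      rcases Multiset.mem_add.1 hU with hU | hU <;> obtain ⟨V, hV, rfl⟩ := Multiset.mem_map.1 hU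
      · rw [valency_attach, valency_attach, hv V hV]
      · rw [valency_attach, valency_attach]

/-- Induction that expresses `T.attach S` through the grafting of `S` on `T`. -/
theorem graft_induction {p : RTree → Prop} (vertex : p vertex)
    (graft : ∀ T S W, graft T S = T.attach S ::ₘ W → p T → p S → (∀ U ∈ W, p U) →
      p (T.attach S)) (T : RTree) : p T := by
  -- Lexicographic induction on degree and root valency: the trees in `W` have the degree of
  -- `T.attach S` and one branch fewer on the root.
  suffices H : ∀ n v, ∀ T : RTree, T.degree = n → T.valency = v → p T from H _ _ T rfl rfl
  intro n
  induction n using Nat.strong_induction_on with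
  | _ n ihn =>
    intro v
    induction v using Nat.strong_induction_on with
    | _ v ihv =>
      intro T hn hv
      induction T using attach_induction with
      | vertex => exact vertex
      | attach T S _ _ =>
        obtain ⟨W, hW, hval⟩ := exists_graft_eq_cons T S
        have hS := S.degree_pos
        have hT := T.degree_pos
        rw [degree_attach] at hn
        rw [valency_attach] at hv
        refine graft T S W hW (ihn _ (by omega) _ T rfl rfl) (ihn _ (by omega) _ S rfl rfl)
          fun U hU => ihv T.valency (by omega) U ?_ (hval U hU)
        rw [degree_of_mem_graft (hW ▸ Multiset.mem_cons_of_mem hU), hn]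

theorem degree_linear (n : ℕ) : (linear n).degree = n + 1 := by
  induction n with
  | zero => rfl
  | succ n ih =>
    rw [linear, degree_attach, ih, add_comm]
    rfl

end RTree

/-! ### Dendriform images of rooted trees and the degree filtration -/

namespace DendU

open BinaryTree Multiset

variable {K : Type*} [CommRing K]

/-- The images in the dendriform algebra of the branches of a planar rooted tree. -/
def planarBranches : PlanarTree → Multiset (DendU K)
  | PlanarTree.vertex => 0
  | PlanarTree.attach t s => brace (planarBranches s) ::ₘ planarBranches t

theorem planarBranches_reorder {t t' : PlanarTree} (h : PlanarTree.Reorder t t') :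
    planarBranches (K := K) t = planarBranches t' := by
  induction h with
  | swap t r s => exact cons_swap _ _ _
  | left s _ ih => simp only [planarBranches, ih]
  | right t _ ih => simp only [planarBranches, ih]

/-- The images in the dendriform algebra of the branches of a rooted tree. -/
def branches : RTree → Multiset (DendU K) :=
  Quot.lift planarBranches fun _ _ h => planarBranches_reorder h

/-- The image of a rooted tree in the dendriform algebra. -/
def ofRTree (T : RTree) : DendU K := brace (branches T)

theorem branches_attach (T S : RTree) :
    branches (K := K) (T.attach S) = ofRTree S ::ₘ branches T := by
  induction T using RTree.ind
  induction S using RTree.ind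
  rfl

theorem ofRTree_vertex : ofRTree (K := K) RTree.vertex = Y := brace_zero

@[simp] theorem ofRTree_nil (T : RTree) : ofRTree (K := K) T nil = 0 := brace_nil _

/-- `S` is grafted either on the root, adding a branch, or inside a branch, which changes the image
`x` of that branch into `x ↶ ofRTree S`. A general `h` is needed because the induction on `T`
absorbs each attached branch into `h`; the application is `h = brace`. -/
theorem sum_map_branches_graft (T S : RTree) {h : Multiset (DendU K) → DendU K}
    (hh : Multiadditive h) :
    ((RTree.graft T S).map fun U => h (branches U)).sum =
      h (ofRTree S ::ₘ branches T) +
        sumErase (fun x r => h (prelieₗ x (ofRTree S) ::ₘ r)) (branches T) := by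
  induction T using RTree.attach_induction generalizing h with
  | vertex =>
    rw [RTree.graft_vertex, map_singleton, sum_singleton, branches_attach]
    exact (add_zero _).symm
  | attach T R ihT ihR =>
    have hR : ((RTree.graft R S).map ofRTree).sum =
        prelieₗ (ofRTree (K := K) R) (ofRTree S) :=
      (ihR multiadditive_brace).trans (brace_cons_add (ofRTree_nil S) _)
    rw [RTree.graft_attach, Multiset.map_add, sum_add, map_map, map_map]
    simp only [Function.comp_def, branches_attach]
    rw [ihT (hh.cons _), sumErase_cons, ← hR, hh.map_sum, map_map, cons_swap]
    simp only [Function.comp_def, cons_swap (ofRTree R)]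
    abel

theorem sum_map_ofRTree_graft (T S : RTree) :
    ((RTree.graft T S).map ofRTree).sum = prelieₗ (ofRTree (K := K) T) (ofRTree S) :=
  (sum_map_branches_graft T S multiadditive_brace).trans (brace_cons_add (ofRTree_nil S) _)

/-- The series whose terms of degree less than `n` vanish. -/
def filt (n : ℕ) : Submodule K (DendU K) where
  carrier := {f | ∀ t : PBTree, t.numNodes < n → f t = 0}
  add_mem' {f g} hf hg t ht := by rw [add_apply, hf t ht, hg t ht, add_zero]
  zero_mem' _ _ := rfl
  smul_mem' c f hf t ht := by rw [smul_apply, hf t ht, mul_zero]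

theorem filt_anti {m n : ℕ} (h : m ≤ n) {f : DendU K} (hf : f ∈ filt n) : f ∈ filt m :=
  fun t ht => hf t (ht.trans_le h)

theorem mem_filt_zero (f : DendU K) : f ∈ filt 0 := fun _ ht => absurd ht (Nat.not_lt_zero _)

theorem mem_filt_one {f : DendU K} : f ∈ filt 1 ↔ f nil = 0 := by
  refine ⟨fun h => h nil Nat.one_pos, fun h t ht => ?_⟩
  cases t with
  | nil => exact h
  | node _ a b => simp [numNodes] at ht

theorem eq_of_forall_sub_mem_filt {f g : DendU K} (h : ∀ n, f - g ∈ filt n) : f = g := by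
  ext t
  exact sub_eq_zero.1 (h (t.numNodes + 1) t (Nat.lt_succ_self _))

theorem mulCoeff_eq_zero (t : PBTree) {m n : ℕ} {f g : PBTree → K}
    (hf : ∀ x : PBTree, x.numNodes < m → f x = 0) (hg : ∀ x : PBTree, x.numNodes < n → g x = 0)
    (ht : t.numNodes < m + n) : mulCoeff t f g = 0 := by
  induction t generalizing m n f g with
  | nil =>
    rw [mulCoeff]
    simp only [numNodes] at ht
    by_cases hm : 0 < m
    · rw [hf nil hm, zero_mul]
    · rw [hg nil (by simp only [numNodes]; omega), mul_zero]
  | node _ a b iha ihb =>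
    simp only [numNodes] at ht
    -- With the left subtree `a` fixed, `f (a △ ·)` vanishes below degree `m - (a.numNodes + 1)`. If
    -- the subtraction truncates to `0`, then `ht` already gives `b.numNodes < n`.
    rw [mulCoeff, ihb (m := m - (a.numNodes + 1)) (fun x hx => hf _ ?_) hg (by omega),
      iha (n := n - (b.numNodes + 1)) hf (fun x hx => hg _ ?_) (by omega), add_zero]
    · simp only [numNodes]; omega
    · simp only [numNodes]; omega

theorem mul_mem_filt {m n : ℕ} {f g : DendU K} (hf : f ∈ filt m) (hg : g ∈ filt n) :
    f * g ∈ filt (m + n) := fun t ht => mulCoeff_eq_zero t hf hg ht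

theorem prec_mem_filt {m n : ℕ} {f g : DendU K} (hf : f ∈ filt m) (hg : g ∈ filt n) :
    prec f g ∈ filt (m + n) := by
  intro t ht
  cases t with
  | nil => rfl
  | node _ a b =>
    simp only [numNodes] at ht
    refine mulCoeff_eq_zero b (m := m - (a.numNodes + 1)) (fun x hx => hf _ ?_) hg (by omega)
    simp only [numNodes]; omega

theorem succ_mem_filt {m n : ℕ} {f g : DendU K} (hf : f ∈ filt m) (hg : g ∈ filt n) :
    succ f g ∈ filt (m + n) := by
  intro t ht
  cases t with
  | nil => rfl
  | node _ a b =>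
    simp only [numNodes] at ht
    refine mulCoeff_eq_zero a (n := n - (b.numNodes + 1)) hf (fun x hx => hg _ ?_) (by omega)
    simp only [numNodes]; omega

theorem prelieₗ_mem_filt {m n : ℕ} {f g : DendU K} (hf : f ∈ filt m) (hg : g ∈ filt n) :
    prelieₗ f g ∈ filt (m + n) :=
  sub_mem (add_comm n m ▸ succ_mem_filt hg hf) (prec_mem_filt hf hg)

theorem Y_mem_filt : (Y : DendU K) ∈ filt 1 := mem_filt_one.2 (by simp [Y, tree])

theorem ofRTree_mem_filt (T : RTree) : ofRTree (K := K) T ∈ filt T.degree := by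
  induction T using RTree.graft_induction with
  | vertex => rw [ofRTree_vertex]; exact Y_mem_filt
  | graft T S W hW hT hS ih =>
    have h := sum_map_ofRTree_graft (K := K) T S
    rw [hW, map_cons, sum_cons, ← eq_sub_iff_add_eq] at h
    rw [h, RTree.degree_attach]
    refine sub_mem (prelieₗ_mem_filt hT hS) (_root_.multiset_sum_mem _ fun f hf => ?_)
    obtain ⟨U, hU, rfl⟩ := mem_map.1 hf
    rw [← RTree.degree_of_mem_graft (hW ▸ mem_cons_of_mem hU)]
    exact ih U hU

end DendU

/-! ### Bilinearity, filtration and truncation of tree series -/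

namespace PLHat

variable {K : Type*} [CommRing K]

open Classical in
/-- The pre-Lie product as a bilinear map. -/
def prelieₗ : PLHat K →ₗ[K] PLHat K →ₗ[K] PLHat K :=
  LinearMap.mk₂ K prelie
    (fun A A' B => funext fun T => by
      simp only [prelie, Pi.add_apply, add_mul]
      exact finsum_add_distrib (prelie_support_finite _ _ _) (prelie_support_finite _ _ _))
    (fun c A B => funext fun T => by
      simp only [prelie, Pi.smul_apply, smul_eq_mul, mul_assoc]
      have := prelie_support_finite A B T
      simp only [mul_assoc] at this
      exact (mul_finsum' _ c this).symm)
    (fun A B B' => funext fun T => by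
      simp only [prelie, Pi.add_apply, mul_add, add_mul]
      exact finsum_add_distrib (prelie_support_finite _ _ _) (prelie_support_finite _ _ _))
    (fun c A B => funext fun T => by
      simp only [prelie, Pi.smul_apply, smul_eq_mul, mul_left_comm _ c, mul_assoc c]
      exact (mul_finsum' _ c (prelie_support_finite A B T)).symm)

theorem prelieₗ_apply (A B : PLHat K) : prelieₗ A B = prelie A B := rfl

/-- The series whose terms of degree less than `n` vanish. -/
def filt (n : ℕ) : Submodule K (PLHat K) where
  carrier := {A | ∀ T : RTree, T.degree < n → A T = 0}
  add_mem' {A B} hA hB T hT := by rw [Pi.add_apply, hA T hT, hB T hT, add_zero]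
  zero_mem' _ _ := rfl
  smul_mem' c A hA T hT := by rw [Pi.smul_apply, hA T hT, smul_zero]

theorem filt_anti {m n : ℕ} (h : m ≤ n) {A : PLHat K} (hA : A ∈ filt n) : A ∈ filt m :=
  fun T hT => hA T (hT.trans_le h)

theorem mem_filt_one (A : PLHat K) : A ∈ filt 1 := fun T hT => by
  have := T.degree_pos
  omega

theorem eq_of_forall_sub_mem_filt {A B : PLHat K} (h : ∀ n, A - B ∈ filt n) : A = B :=
  funext fun T => sub_eq_zero.1 (h (T.degree + 1) T (Nat.lt_succ_self _))

theorem prelie_mem_filt {m n : ℕ} {A B : PLHat K} (hA : A ∈ filt m) (hB : B ∈ filt n) :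
    prelie A B ∈ filt (m + n) := by
  classical
  intro T hT
  refine (finsum_congr fun p => ?_).trans finsum_zero
  by_cases h : T ∈ RTree.graft p.1 p.2
  · have h1 := RTree.degree_of_mem_graft h
    by_cases hp : p.1.degree < m
    · rw [hA _ hp, zero_mul, zero_mul]
    · rw [hB p.2 (by omega), mul_zero, zero_mul]
  · rw [Multiset.count_eq_zero_of_notMem h, Nat.cast_zero, mul_zero]

theorem prelie_tree_tree (S R : RTree) :
    prelie (tree S) (tree R) = ((RTree.graft S R).map (tree (K := K))).sum := by
  classical
  funext T
  rw [prelie_tree]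
  induction RTree.graft S R using Multiset.induction with
  | empty => simp
  | cons U W ih =>
    rw [Multiset.map_cons, Multiset.sum_cons, Pi.add_apply, ← ih, Multiset.count_cons, Nat.cast_add,
      add_comm]
    simp [tree, Pi.single_apply]

/-- The finite set of rooted trees of degree less than `n`. -/
def treesLT (n : ℕ) : Finset RTree :=
  ((RTree.finite_degree_le n).subset fun (T : RTree) (h : T.degree < n) => le_of_lt h).toFinset

@[simp] theorem mem_treesLT {n : ℕ} {T : RTree} : T ∈ treesLT n ↔ T.degree < n :=
  Set.Finite.mem_toFinset _

/-- The terms of degree less than `n` of a series. -/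
def truncate (n : ℕ) (A : PLHat K) : PLHat K := ∑ T ∈ treesLT n, A T • tree T

theorem sub_truncate_mem_filt (n : ℕ) (A : PLHat K) : A - truncate n A ∈ filt n := by
  classical
  intro T hT
  rw [Pi.sub_apply, truncate, Finset.sum_apply, Finset.sum_eq_single T]
  · simp [tree]
  · intro S _ h
    simp [tree, h.symm]
  · simp [hT]

end PLHat

/-! ### Existence and uniqueness of `φ` -/

/-- The canonical morphism of pre-Lie algebras from rooted trees to dendriform series. -/
def phiHat (K : Type*) [CommRing K] : PLHat K →ₗ[K] DendHat K where
  -- Trees of degree above `t.numNodes` have coefficient zero at `t`, by `ofRTree_mem_filt`, so the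
  -- finite sum loses nothing.
  toFun A := ⟨fun t => ∑ T ∈ PLHat.treesLT (t.numNodes + 1), A T * DendU.ofRTree T t,
    Finset.sum_eq_zero fun T _ => by rw [DendU.ofRTree_nil, mul_zero]⟩
  map_add' A B := Subtype.ext (DendU.ext fun t => by
    simp only [Pi.add_apply, add_mul, Finset.sum_add_distrib]
    rfl)
  map_smul' c A := Subtype.ext (DendU.ext fun t => by
    simp only [Pi.smul_apply, smul_eq_mul, mul_assoc, ← Finset.mul_sum]
    rfl)

section PhiHat

variable {K : Type*} [CommRing K]

theorem phiHat_apply (A : PLHat K) (t : PBTree) : (phiHat K A : DendU K) t =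
    ∑ T ∈ PLHat.treesLT (t.numNodes + 1), A T * DendU.ofRTree T t := rfl

theorem phiHat_mem_filt {n : ℕ} {A : PLHat K} (hA : A ∈ PLHat.filt n) :
    (phiHat K A : DendU K) ∈ DendU.filt n := by
  intro t ht
  rw [phiHat_apply]
  refine Finset.sum_eq_zero fun T hT => ?_
  rw [PLHat.mem_treesLT] at hT
  rw [hA T (by omega), zero_mul]

theorem phiHat_tree (T : RTree) : (phiHat K (PLHat.tree T) : DendU K) = DendU.ofRTree T := by
  classical
  ext t
  rw [phiHat_apply, Finset.sum_eq_single T]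
  · simp [PLHat.tree]
  · intro S _ h
    simp [PLHat.tree, h]
  · intro h
    rw [PLHat.mem_treesLT] at h
    rw [DendU.ofRTree_mem_filt T t (by omega), mul_zero]

/-- The defect `β` is bilinear, compatible with the filtrations, and zero on pairs of trees by
`sum_map_ofRTree_graft`. Truncating both arguments shows that it vanishes to every order. -/
theorem phiHat_prelie (A B : PLHat K) : (phiHat K (PLHat.prelie A B) : DendU K) =
    DendU.prelieₗ (phiHat K A : DendU K) (phiHat K B) := by
  let ψ : PLHat K →ₗ[K] DendU K := (DendHat K).subtype ∘ₗ phiHat K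
  let β : PLHat K →ₗ[K] PLHat K →ₗ[K] DendU K :=
    PLHat.prelieₗ.compr₂ ψ - DendU.prelieₗ.compl₁₂ ψ ψ
  have hψ : ∀ {n A}, A ∈ PLHat.filt n → ψ A ∈ DendU.filt n := phiHat_mem_filt
  have hβ : ∀ {m n : ℕ} {A B : PLHat K}, A ∈ PLHat.filt m → B ∈ PLHat.filt n →
      β A B ∈ DendU.filt (m + n) := fun hA hB =>
    sub_mem (hψ (PLHat.prelie_mem_filt hA hB)) (DendU.prelieₗ_mem_filt (hψ hA) (hψ hB))
  have htree : ∀ S R, β (PLHat.tree S) (PLHat.tree R) = 0 := fun S R => by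
    refine sub_eq_zero.2 ?_
    change ψ (PLHat.prelie (PLHat.tree S) (PLHat.tree R)) =
      DendU.prelieₗ (phiHat K (PLHat.tree S) : DendU K) (phiHat K (PLHat.tree R) : DendU K)
    rw [PLHat.prelie_tree_tree, phiHat_tree, phiHat_tree, ← DendU.sum_map_ofRTree_graft,
      map_multiset_sum, Multiset.map_map]
    exact congrArg _ (Multiset.map_congr rfl fun U _ => phiHat_tree U)
  refine DendU.eq_of_forall_sub_mem_filt fun n => ?_
  have h0 : β (A.truncate n) (B.truncate n) = 0 := by
    simp only [PLHat.truncate, map_sum, map_smul, LinearMap.sum_apply, LinearMap.smul_apply, htree,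
      smul_zero, Finset.sum_const_zero]
  have h1 : β A B = β (A - A.truncate n) B + β (A.truncate n) (B - B.truncate n) := by
    rw [map_sub β, map_sub (β (A.truncate n)), h0, LinearMap.sub_apply (β A)]
    abel
  change β A B ∈ _
  rw [h1]
  refine add_mem (DendU.filt_anti (Nat.le_add_right n 1)
    (hβ (PLHat.sub_truncate_mem_filt n A) (PLHat.mem_filt_one B))) (DendU.filt_anti
    (Nat.le_add_left n 1) (hβ (PLHat.mem_filt_one _) (PLHat.sub_truncate_mem_filt n B)))

theorem isPhi_phiHat : IsPhi (phiHat K) where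
  map_vertex := by rw [phiHat_tree, DendU.ofRTree_vertex]
  map_prelie := phiHat_prelie
  continuous m := ⟨m, fun A hA t ht => phiHat_mem_filt (n := m + 1)
    (fun T hT => hA T (Nat.le_of_lt_succ hT)) t (Nat.lt_succ_of_le ht)⟩

/-- In the image of `T ↶ S`, every term except that of `T.attach S` is known by `graft_induction`,
so the remaining one is forced. -/
theorem IsPhi.map_tree {Φ : PLHat K →ₗ[K] DendHat K} (h : IsPhi Φ) (T : RTree) :
    (Φ (PLHat.tree T) : DendU K) = DendU.ofRTree T := by
  induction T using RTree.graft_induction with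
  | vertex => rw [h.map_vertex, DendU.ofRTree_vertex]
  | graft T S W hW hT hS ih =>
    let ψ : PLHat K →ₗ[K] DendU K := (DendHat K).subtype ∘ₗ Φ
    have h1 : ψ (PLHat.prelie (PLHat.tree T) (PLHat.tree S)) = _ := h.map_prelie _ _
    rw [hT, hS, PLHat.prelie_tree_tree, hW, Multiset.map_cons, Multiset.sum_cons, map_add,
      map_multiset_sum, Multiset.map_map, ← DendU.prelieₗ_apply, ← DendU.sum_map_ofRTree_graft, hW,
      Multiset.map_cons, Multiset.sum_cons, 
      Multiset.map_congr (f := ψ ∘ PLHat.tree) rfl ih] at h1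
    exact add_right_cancel h1

theorem IsPhi.eq_phiHat {Φ : PLHat K →ₗ[K] DendHat K} (h : IsPhi Φ) : Φ = phiHat K := by
  refine LinearMap.ext fun A => Subtype.ext (DendU.ext fun t => ?_)
  obtain ⟨n, hn⟩ := h.continuous t.numNodes
  -- Beyond this degree the tail of `A` contributes at `t` neither to `Φ`, by continuity, nor to
  -- `phiHat`.
  let N := max n t.numNodes + 1
  have h1 := hn (A - A.truncate N)
    (fun T hT => PLHat.sub_truncate_mem_filt N A T (by omega)) t le_rfl
  have h2 := phiHat_mem_filt (PLHat.sub_truncate_mem_filt N A) t (by omega)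
  have h3 : (Φ (A.truncate N) : DendU K) = phiHat K (A.truncate N) := by
    simp only [PLHat.truncate, map_sum, map_smul, Submodule.coe_sum, Submodule.coe_smul, h.map_tree,
      phiHat_tree]
  rw [map_sub, Submodule.coe_sub, DendU.sub_apply, sub_eq_zero] at h1 h2
  rw [h1, h2, h3]

theorem existsUnique_isPhi : ∃! Φ : PLHat K →ₗ[K] DendHat K, IsPhi Φ :=
  ⟨phiHat K, isPhi_phiHat, fun _ h => h.eq_phiHat⟩

end PhiHat

/-! ### Contractions for the degree; existence and uniqueness of `Ω` and `Ω_q` -/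

namespace PLHat

variable {K : Type*} [CommRing K]

/-- A map that strictly contracts the filtration by the degree has exactly one fixed point. -/
theorem existsUnique_fixedPoint (Ψ : PLHat K → PLHat K)
    (hΨ : ∀ n A B, A - B ∈ filt n → Ψ A - Ψ B ∈ filt (n + 1)) : ∃! A, Ψ A = A := by
  have hstep : ∀ n, Ψ^[n + 1] 0 - Ψ^[n] 0 ∈ filt n := by
    intro n
    induction n with
    | zero => exact fun T hT => absurd hT (Nat.not_lt_zero _)
    | succ n ih =>
      simpa only [Function.iterate_succ_apply'] using hΨ _ _ _ ih
  have hlim : ∀ n k, Ψ^[n + k] 0 - Ψ^[n] 0 ∈ filt n := by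
    intro n k
    induction k with
    | zero => rw [add_zero, sub_self]; exact zero_mem _
    | succ k ih =>
      rw [← sub_add_sub_cancel _ (Ψ^[n + k] 0)]
      exact add_mem (filt_anti (Nat.le_add_right n k) (hstep (n + k))) ih
  -- The coefficient at `T` is constant from the iterate `T.degree + 1` on.
  let A : PLHat K := fun T => Ψ^[T.degree + 1] 0 T
  have hA : ∀ n, A - Ψ^[n] 0 ∈ filt n := by
    intro n T hT
    obtain ⟨k, rfl⟩ := Nat.exists_eq_add_of_lt hT
    have := hlim (T.degree + 1) k T (Nat.lt_succ_self _)
    rw [add_right_comm] at this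
    exact sub_eq_zero.2 (sub_eq_zero.1 this).symm
  refine ⟨A, eq_of_forall_sub_mem_filt fun n => ?_, fun B hB => ?_⟩
  · rw [← sub_add_sub_cancel _ (Ψ (Ψ^[n] 0))]
    refine add_mem (filt_anti n.le_succ (hΨ _ _ _ (hA n))) ?_
    rw [← Function.iterate_succ_apply' Ψ, ← neg_sub]
    exact neg_mem (filt_anti n.le_succ (hA (n + 1)))
  · refine eq_of_forall_sub_mem_filt fun n => ?_
    rw [← sub_add_sub_cancel _ (Ψ^[n] 0), ← neg_sub A]
    refine add_mem ?_ (neg_mem (hA n))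
    induction n with
    | zero => exact fun T hT => absurd hT (Nat.not_lt_zero _)
    | succ n ih =>
      rw [Function.iterate_succ_apply', ← hB]
      simpa only [hB] using hΨ _ _ _ ih

theorem rightMul_sub (A A' B : PLHat K) (k : ℕ) :
    rightMul B k (A - A') = rightMul B k A - rightMul B k A' := by
  induction k with
  | zero => rfl
  | succ k ih => simp only [rightMul, ih, ← prelieₗ_apply, map_sub, LinearMap.sub_apply]

theorem rightMul_mem_filt {n : ℕ} {A : PLHat K} (B : PLHat K) (hA : A ∈ filt n) (k : ℕ) :
    rightMul B k A ∈ filt (n + k) := by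
  induction k with
  | zero => exact hA
  | succ k ih =>
    have := prelie_mem_filt ih (mem_filt_one B)
    exact this

/-- The gain of one degree comes from the left argument of `↶`, since every tree has at least one
vertex. It is what makes the equation of `Ω` contracting. -/
theorem rightMul_sub_rightMul_mem_filt (A : PLHat K) {n : ℕ} {B B' : PLHat K}
    (h : B - B' ∈ filt n) (k : ℕ) : rightMul B k A - rightMul B' k A ∈ filt (n + 1) := by
  induction k with
  | zero => rw [rightMul, rightMul, sub_self]; exact zero_mem _
  | succ k ih =>
    have : rightMul B (k + 1) A - rightMul B' (k + 1) A =
        prelieₗ (rightMul B k A - rightMul B' k A) B + prelieₗ (rightMul B' k A) (B - B') := by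
      rw [map_sub, map_sub, LinearMap.sub_apply, sub_add_sub_cancel]
      rfl
    rw [this]
    exact add_mem (filt_anti (Nat.le_succ _) (prelie_mem_filt ih (mem_filt_one B)))
      (add_comm 1 n ▸ prelie_mem_filt (mem_filt_one _) h)

theorem act_sub_left (f : K⟦X⟧) (A A' B : PLHat K) : act f (A - A') B = act f A B - act f A' B := by
  funext T
  simp only [Pi.sub_apply, act_eq_sum, rightMul_sub, mul_sub, Finset.sum_sub_distrib]

theorem act_sub_act_mem_filt (f : K⟦X⟧) (A : PLHat K) {n : ℕ} {B B' : PLHat K}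
    (h : B - B' ∈ filt n) : act f A B - act f A B' ∈ filt (n + 1) := by
  intro T hT
  simp only [Pi.sub_apply, act_eq_sum, ← Finset.sum_sub_distrib, ← mul_sub]
  refine Finset.sum_eq_zero fun k _ => ?_
  rw [← Pi.sub_apply, rightMul_sub_rightMul_mem_filt A h k T hT, mul_zero]

theorem act_mem_filt {f : K⟦X⟧} (hf : PowerSeries.coeff 0 f = 0) {n : ℕ} {A : PLHat K}
    (hA : A ∈ filt n) (B : PLHat K) : act f A B ∈ filt (n + 1) := by
  intro T hT
  rw [act_eq_sum]
  refine Finset.sum_eq_zero fun k _ => ?_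
  cases k with
  | zero => rw [hf, zero_mul]
  | succ k => rw [rightMul_mem_filt B hA (k + 1) T (by omega), mul_zero]

theorem act_sub_sum_mem_filt (f : K⟦X⟧) (A B : PLHat K) (n : ℕ) :
    act f A B - ∑ k ∈ Finset.range n, PowerSeries.coeff k f • rightMul B k A ∈ filt n := by
  intro T hT
  simp only [Pi.sub_apply, act_eq_sum, Finset.sum_apply, Pi.smul_apply, smul_eq_mul]
  rw [sub_eq_zero]
  refine Finset.sum_subset (Finset.range_subset_range.2 hT.le) fun k _ hk => ?_
  rw [Finset.mem_range, not_lt] at hk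
  rw [rightMul_eq_zero A B hk, mul_zero]

theorem qShift_sub (q : K) (A B : PLHat K) : qShift q (A - B) = qShift q A - qShift q B := by
  funext T
  exact mul_sub _ _ _

theorem qShift_mem_filt (q : K) {n : ℕ} {A : PLHat K} (hA : A ∈ filt n) : qShift q A ∈ filt n :=
  fun T hT => by rw [qShift, hA T hT, mul_zero]

section Map

variable {L : Type*} [CommRing L] (ψ : K →+* L)

theorem map_prelie (A B : PLHat K) :
    (fun T => ψ (prelie A B T)) = prelie (fun T => ψ (A T)) (fun T => ψ (B T)) := by
  classical
  funext T
  refine (ψ.toAddMonoidHom.map_finsum (prelie_support_finite A B T)).trans ?_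
  refine finsum_congr fun p => ?_
  simp

theorem map_rightMul (A B : PLHat K) (k : ℕ) :
    (fun T => ψ (rightMul B k A T)) = rightMul (fun T => ψ (B T)) k (fun T => ψ (A T)) := by
  induction k with
  | zero => rfl
  | succ k ih => rw [rightMul, rightMul, map_prelie, ih]

theorem map_act (f : K⟦X⟧) (A B : PLHat K) :
    (fun T => ψ (act f A B T)) =
      act (PowerSeries.map ψ f) (fun T => ψ (A T)) (fun T => ψ (B T)) := by
  funext T
  simp only [act_eq_sum, map_sum, map_mul, PowerSeries.coeff_map, ← map_rightMul]

theorem map_tree (T : RTree) : (fun S => ψ (tree T S)) = tree T := by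
  classical
  funext S
  by_cases h : S = T
  · subst h; simp [tree]
  · simp [tree, h]

end Map

end PLHat

theorem existsUnique_isOmega : ∃! Ω : PLHat ℚ, IsOmega Ω :=
  PLHat.existsUnique_fixedPoint _ fun _ _ _ h => PLHat.act_sub_act_mem_filt _ _ h

theorem qVar_pow_sub_one_ne_zero {n : ℕ} (hn : 0 < n) : qVar ^ n - 1 ≠ 0 := by
  have h : (Polynomial.X ^ n - 1 : Polynomial ℚ) ≠ 0 :=
    (Polynomial.monic_X_pow_sub_C 1 hn.ne').ne_zero
  have := RatFunc.algebraMap_ne_zero h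
  simpa using this

/-- In degree `n` the difference `Ω_q[q] - Ω_q` is multiplication by `qⁿ - 1`, which is invertible.
The other terms involving `Ω_q` raise the degree, so solving for `Ω_q` gives the fixed points of a
contraction. -/
theorem existsUnique_isOmegaQ (Ω : PLHat ℚ) : ∃! Ωq : PLHat (RatFunc ℚ), IsOmegaQ Ω Ωq := by
  let Ω' : PLHat (RatFunc ℚ) := fun T => algebraMap ℚ (RatFunc ℚ) (Ω T)
  let R : PLHat (RatFunc ℚ) → PLHat (RatFunc ℚ) := fun A =>
    PLHat.prelie (PLHat.tree RTree.vertex) A + (qVar - 1) • PLHat.tree RTree.vertex -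
      PLHat.act (PowerSeries.exp (RatFunc ℚ) - 1) (PLHat.qShift qVar A) Ω'
  have hR : ∀ n A B, A - B ∈ PLHat.filt n → R A - R B ∈ PLHat.filt (n + 1) := by
    intro n A B h
    have : R A - R B = PLHat.prelieₗ (PLHat.tree RTree.vertex) (A - B) -
        PLHat.act (PowerSeries.exp (RatFunc ℚ) - 1) (PLHat.qShift qVar (A - B)) Ω' := by
      rw [PLHat.qShift_sub, PLHat.act_sub_left, map_sub, PLHat.prelieₗ_apply, PLHat.prelieₗ_apply]
      simp only [R]
      abel
    rw [this]
    exact sub_mem (add_comm 1 n ▸ PLHat.prelie_mem_filt (PLHat.mem_filt_one _) h)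
      (PLHat.act_mem_filt (by simp) (PLHat.qShift_mem_filt _ h) _)
  have key := PLHat.existsUnique_fixedPoint (fun A T => (qVar ^ T.degree - 1)⁻¹ * R A T)
    fun n A B h T hT => by
      rw [Pi.sub_apply, ← mul_sub, ← Pi.sub_apply, hR n A B h T hT, mul_zero]
  refine (existsUnique_congr fun A => ?_).1 key
  rw [IsOmegaQ, funext_iff, funext_iff]
  refine forall_congr' fun T => ?_
  rw [inv_mul_eq_iff_eq_mul₀ (qVar_pow_sub_one_ne_zero T.degree_pos)]
  simp only [R, Pi.add_apply, Pi.sub_apply, PLHat.qShift]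
  constructor <;> intro h
  · linear_combination -h
  · linear_combination -h

/-! ### Convergent series, the exponential and conjugation -/

namespace DendU

open BinaryTree

section Series

variable {K : Type*} [CommRing K]

/-- `S` is the sum of the series with terms `x k`, where the `n`-th remainder is required to have
no terms of degree less than `n`. -/
def HasSeries (x : ℕ → DendU K) (S : DendU K) : Prop :=
  ∀ n, S - ∑ k ∈ Finset.range n, x k ∈ filt n

theorem sum_apply {ι : Type*} (s : Finset ι) (x : ι → DendU K) (t : PBTree) :
    (∑ k ∈ s, x k) t = ∑ k ∈ s, x k t :=
  Finset.sum_apply t s x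

theorem exists_hasSeries {x : ℕ → DendU K} (hx : ∀ k, x k ∈ filt k) : ∃ S, HasSeries x S := by
  refine ⟨fun t => ∑ k ∈ Finset.range (t.numNodes + 1), x k t, fun n t ht => ?_⟩
  refine ((sub_apply _ _ t).trans (congrArg _ (sum_apply _ x t))).trans (sub_eq_zero.2 ?_)
  refine Finset.sum_subset (Finset.range_subset_range.2 ht) fun k _ hk => ?_
  rw [Finset.mem_range, not_lt] at hk
  exact hx k t hk

theorem HasSeries.unique {x : ℕ → DendU K} {S S' : DendU K} (h : HasSeries x S)
    (h' : HasSeries x S') : S = S' :=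
  eq_of_forall_sub_mem_filt fun n => by
    rw [← sub_sub_sub_cancel_right S S' (∑ k ∈ Finset.range n, x k)]
    exact sub_mem (h n) (h' n)

theorem HasSeries.map {x : ℕ → DendU K} {S : DendU K} (h : HasSeries x S)
    (D : DendU K →ₗ[K] DendU K) (hD : ∀ n f, f ∈ filt n → D f ∈ filt n) :
    HasSeries (fun k => D (x k)) (D S) := fun n => by
  rw [← map_sum, ← map_sub]
  exact hD n _ (h n)

theorem HasSeries.prec {x y : ℕ → DendU K} {S F : DendU K} (hS : HasSeries x S)
    (hF : HasSeries y F) (hx : ∀ k, x k ∈ filt k) :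
    HasSeries (fun n => ∑ k ∈ Finset.range (n + 1), precₗ (x k) (y (n - k))) (precₗ S F) := by
  intro n
  rw [Finset.sum_range_diag_flip n fun k m => precₗ (x k) (y m)]
  have h : precₗ S F - ∑ k ∈ Finset.range n, ∑ m ∈ Finset.range (n - k), precₗ (x k) (y m) =
      precₗ (S - ∑ k ∈ Finset.range n, x k) F +
        ∑ k ∈ Finset.range n, precₗ (x k) (F - ∑ m ∈ Finset.range (n - k), y m) := by
    simp only [map_sub, map_sum, LinearMap.sub_apply, LinearMap.sum_apply, Finset.sum_sub_distrib]
    abel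
  rw [h]
  refine add_mem (prec_mem_filt (hS n) (mem_filt_zero F)) (sum_mem fun k hk => ?_)
  rw [Finset.mem_range] at hk
  have := prec_mem_filt (hx k) (hF (n - k))
  rwa [Nat.add_sub_cancel' hk.le] at this

theorem pow_apply_mem_filt {D : Module.End K (DendU K)}
    (hD : ∀ n f, f ∈ filt n → D f ∈ filt (n + 1)) {n : ℕ} {f : DendU K}
    (hf : f ∈ filt n) (k : ℕ) : (D ^ k) f ∈ filt (n + k) := by
  induction k with
  | zero => exact hf
  | succ k ih =>
    rw [pow_succ']
    exact hD _ _ ih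

/-- From `z = f(D) y` and `g f = 1` follows `y = g(D) z`; the series in `D` converge because `D`
raises the degree. -/
theorem HasSeries.inverse {D : Module.End K (DendU K)}
    (hD : ∀ n f, f ∈ filt n → D f ∈ filt (n + 1)) {f g : K⟦X⟧} (hfg : g * f = 1) {y z : DendU K}
    (h : HasSeries (fun k => PowerSeries.coeff k f • (D ^ k) y) z) :
    HasSeries (fun k => PowerSeries.coeff k g • (D ^ k) z) y := by
  intro n
  have h1 : ∑ k ∈ Finset.range n, ∑ j ∈ Finset.range (n - k),
      PowerSeries.coeff k g • (D ^ k) (PowerSeries.coeff j f • (D ^ j) y) =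
        ∑ m ∈ Finset.range n, PowerSeries.coeff m (1 : K⟦X⟧) • (D ^ m) y := by
    rw [← Finset.sum_range_diag_flip n fun k j =>
      PowerSeries.coeff k g • (D ^ k) (PowerSeries.coeff j f • (D ^ j) y)]
    refine Finset.sum_congr rfl fun m _ => ?_
    rw [← hfg, PowerSeries.coeff_mul, Finset.Nat.sum_antidiagonal_eq_sum_range_succ fun i j =>
      PowerSeries.coeff i g * PowerSeries.coeff j f, Finset.sum_smul]
    refine Finset.sum_congr rfl fun k hk => ?_
    rw [map_smul, smul_smul, ← Module.End.mul_apply, ← pow_add,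
      Nat.add_sub_cancel' (Finset.mem_range_succ_iff.1 hk)]
  cases n with
  | zero => exact mem_filt_zero _
  | succ n =>
    have h2 : ∑ m ∈ Finset.range (n + 1), PowerSeries.coeff m (1 : K⟦X⟧) • (D ^ m) y = y := by
      rw [Finset.sum_range_succ', Finset.sum_eq_zero fun m _ => ?_]
      · simp
      · simp [PowerSeries.coeff_one]
    have h3 := h1.trans h2
    have h4 : y - ∑ k ∈ Finset.range (n + 1), PowerSeries.coeff k g • (D ^ k) z =
        -∑ k ∈ Finset.range (n + 1), PowerSeries.coeff k g • (D ^ k)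
          (z - ∑ j ∈ Finset.range (n + 1 - k), PowerSeries.coeff j f • (D ^ j) y) := by
      conv_lhs => rw [← h3]
      simp only [map_sub, map_sum, smul_sub, Finset.smul_sum, Finset.sum_sub_distrib]
      abel
    rw [h4]
    refine neg_mem (sum_mem fun k hk => Submodule.smul_mem _ _ ?_)
    have := pow_apply_mem_filt hD (h (n + 1 - k)) k
    rwa [Nat.sub_add_cancel (Finset.mem_range.1 hk).le] at this

/-- The geometric series for `(1 + D)⁻¹` applied to `x 0`, which telescopes. -/
theorem HasSeries.add_apply_eq {D : DendU K →ₗ[K] DendU K} (hD : ∀ n f, f ∈ filt n → D f ∈ filt n)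
    {x : ℕ → DendU K} {S : DendU K} (h : HasSeries x S) (hx : ∀ k, x (k + 1) = -D (x k)) :
    S + D S = x 0 := by
  refine eq_of_forall_sub_mem_filt fun n => ?_
  have : S + D S - x 0 = S - ∑ k ∈ Finset.range (n + 1), x k +
      D (S - ∑ k ∈ Finset.range n, x k) := by
    rw [Finset.sum_range_succ', map_sub, map_sum]
    simp only [hx, Finset.sum_neg_distrib]
    abel
  rw [this]
  exact add_mem (filt_anti n.le_succ (h (n + 1))) (hD _ _ (h n))

end Series

section Exp

variable {K : Type*} [CommRing K] (ω : DendU K)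

theorem commute_prelieₗ_flip :
    Commute (prelieₗ.flip ω : Module.End K (DendU K)) (precₗ.flip ω) := by
  have h : Commute (succₗ ω : Module.End K (DendU K)) (precₗ.flip ω) :=
    LinearMap.ext fun a => (succ_prec ω a ω).symm
  exact h.sub_left (Commute.refl _)

theorem prec_flip_pow_apply {a : DendU K} (ha : a nil = 0) (m : ℕ) :
    ((precₗ.flip ω : Module.End K (DendU K)) ^ m) a = prec a (ω ^ m) := by
  induction m with
  | zero => exact (prec_one ha).symm
  | succ m ih =>
    rw [pow_succ', Module.End.mul_apply, ih, pow_succ, ← prec_prec]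
    rfl

theorem succ_pow_apply {a : DendU K} (ha : a nil = 0) (m : ℕ) :
    ((succₗ ω : Module.End K (DendU K)) ^ m) a = succ (ω ^ m) a := by
  induction m with
  | zero => exact (one_succ ha).symm
  | succ m ih =>
    rw [pow_succ', Module.End.mul_apply, ih, pow_succ', ← succ_succ]
    rfl

theorem prelieₗ_flip_pow_apply_nil {a : DendU K} (ha : a nil = 0) (m : ℕ) :
    ((prelieₗ.flip ω : Module.End K (DendU K)) ^ m) a nil = 0 := by
  cases m with
  | zero => exact ha
  | succ m =>
    rw [pow_succ', Module.End.mul_apply]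
    exact sub_self (0 : K)

/-- The binomial formula for `ω ≻ · = (· ↶ ω) + (· ≺ ω)`, whose two summands commute by the second
dendriform axiom. -/
theorem sum_choose_prec_pow {a : DendU K} (ha : a nil = 0) (n : ℕ) :
    ∑ k ∈ Finset.range (n + 1), (n.choose k : K) •
      prec (((prelieₗ.flip ω : Module.End K (DendU K)) ^ k) a) (ω ^ (n - k)) =
        succ (ω ^ n) a := by
  have h : (succₗ ω : Module.End K (DendU K)) = prelieₗ.flip ω + precₗ.flip ω :=
    (sub_add_cancel (succₗ ω) (precₗ.flip ω)).symm
  rw [← succ_pow_apply ω ha, h, (commute_prelieₗ_flip ω).add_pow, LinearMap.sum_apply]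
  refine Finset.sum_congr rfl fun k _ => ?_
  rw [← prec_flip_pow_apply ω (prelieₗ_flip_pow_apply_nil ω ha k), ← Module.End.mul_apply,
    ← ((commute_prelieₗ_flip ω).pow_pow k (n - k)).eq,
    Module.End.mul_apply _ (n.choose k : Module.End K (DendU K)),
    Module.End.natCast_apply, map_nsmul, Nat.cast_smul_eq_nsmul]

/-- By Pascal's rule the sum for `n + 1` splits into `ω ^ (n + 1) ≻ ω`, by `sum_choose_prec_pow`,
and `ω ^ (n + 1) ≺ ω`, by induction. -/
theorem sum_choose_succ_prec_pow {ω : DendU K} (hω : ω nil = 0) (n : ℕ) :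
    ∑ k ∈ Finset.range (n + 1), ((n + 1).choose (k + 1) : K) •
      prec (((prelieₗ.flip ω : Module.End K (DendU K)) ^ k) ω) (ω ^ (n - k)) = ω ^ (n + 1) := by
  induction n with
  | zero => simp [prec_one hω]
  | succ n ih =>
    have h1 : ∑ k ∈ Finset.range (n + 1 + 1), ((n + 1).choose (k + 1) : K) •
        prec (((prelieₗ.flip ω : Module.End K (DendU K)) ^ k) ω) (ω ^ (n + 1 - k)) =
          prec (ω ^ (n + 1)) ω := by
      rw [Finset.sum_range_succ, Nat.choose_succ_self, Nat.cast_zero, zero_smul, add_zero, ← ih,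
        ← precₗ_apply (Finset.sum _ _), map_sum, LinearMap.sum_apply]
      refine Finset.sum_congr rfl fun k hk => ?_
      rw [LinearMap.map_smul₂, precₗ_apply, prec_prec, ← pow_succ,
        Nat.sub_add_comm (Finset.mem_range_succ_iff.1 hk)]
    simp only [Nat.choose_succ_succ (n + 1), Nat.cast_add, add_smul, Finset.sum_add_distrib]
    rw [h1, sum_choose_prec_pow ω hω, pow_succ _ (n + 1), mul_eq_succ_add_prec' _ _ hω]

end Exp

section ExpField

variable {K : Type*} [Field K] [CharZero K] {ω F : DendU K}

/-- `sum_choose_prec_pow` divided by `n!` is the term of index `n` in the Cauchy product of `exp(D)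
a` and `exp ω` for `≺`. -/
theorem prec_exp_eq (hF : HasSeries (fun m => ((m ! : ℕ) : K)⁻¹ • ω ^ m) F) (hω : ω ∈ filt 1)
    {a W : DendU K} (ha : a ∈ filt 1) (hW : HasSeries (fun k => ((k ! : ℕ) : K)⁻¹ •
      ((prelieₗ.flip ω : Module.End K (DendU K)) ^ k) a) W) : prec W F = succ F a := by
  have hD : ∀ n f, f ∈ filt n → (prelieₗ.flip ω : Module.End K (DendU K)) f ∈ filt (n + 1) :=
    fun n f hf => prelieₗ_mem_filt hf hω
  have h1 := hW.prec hF fun k => Submodule.smul_mem _ _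
    (filt_anti (Nat.le_add_left k 1) (pow_apply_mem_filt hD ha k))
  have h2 := hF.map (succₗ.flip a) fun n f hf => succ_mem_filt hf (mem_filt_zero a)
  refine h1.unique (Eq.subst (motive := fun x => HasSeries x _) (funext fun n => ?_) h2)
  rw [map_smul, LinearMap.flip_apply, succₗ_apply, ← sum_choose_prec_pow ω (mem_filt_one.1 ha) n,
    Finset.smul_sum]
  refine Finset.sum_congr rfl fun k hk => ?_
  rw [map_smul, LinearMap.map_smul₂, smul_smul, smul_smul, precₗ_apply,
    Nat.cast_choose K (Finset.mem_range_succ_iff.1 hk)]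
  congr 1
  have := Nat.cast_ne_zero (R := K).2 n.factorial_ne_zero
  field_simp

/-- Here `y` is `(exp D - 1) / D` applied to `ω`. The terms come from `sum_choose_succ_prec_pow`
divided by `(n + 1)!`. -/
theorem prec_exp_eq_sub_one (hF : HasSeries (fun m => ((m ! : ℕ) : K)⁻¹ • ω ^ m) F)
    (hω : ω ∈ filt 1) {y : DendU K} (hy : HasSeries (fun k => (((k + 1)! : ℕ) : K)⁻¹ •
      ((prelieₗ.flip ω : Module.End K (DendU K)) ^ k) ω) y) : prec y F = F - 1 := by
  have hD : ∀ n f, f ∈ filt n → (prelieₗ.flip ω : Module.End K (DendU K)) f ∈ filt (n + 1) :=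
    fun n f hf => prelieₗ_mem_filt hf hω
  have h1 := hy.prec hF fun k => Submodule.smul_mem _ _
    (filt_anti (Nat.le_add_left k 1) (pow_apply_mem_filt hD hω k))
  have h2 : HasSeries (fun m => (((m + 1)! : ℕ) : K)⁻¹ • ω ^ (m + 1)) (F - 1) := fun n => by
    have := filt_anti n.le_succ (hF (n + 1))
    rwa [Finset.sum_range_succ', Nat.factorial_zero, Nat.cast_one, inv_one, one_smul, pow_zero,
      add_comm, ← sub_sub] at this
  refine h1.unique (Eq.subst (motive := fun x => HasSeries x _) (funext fun n => ?_) h2)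
  rw [← sum_choose_succ_prec_pow (mem_filt_one.1 hω) n, Finset.smul_sum]
  refine Finset.sum_congr rfl fun k hk => ?_
  have hk' := Finset.mem_range_succ_iff.1 hk
  rw [map_smul, LinearMap.map_smul₂, smul_smul, smul_smul, precₗ_apply,
    Nat.cast_choose K (Nat.succ_le_succ hk'), Nat.succ_sub_succ]
  congr 1
  have := Nat.cast_ne_zero (R := K).2 (n + 1).factorial_ne_zero
  field_simp

end ExpField

/-! ### The comb series and conjugation by them -/

section Comb

variable {K : Type*} [CommRing K]

theorem prec_Y_node (f : DendU K) (a b : PBTree) :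
    prec Y f (node () a b) = if a = nil then f b else 0 := by
  by_cases h : a = nil
  · subst h
    have : (fun x => (Y : DendU K) (node () nil x)) = (tree nil : DendU K) := by
      funext x; simp [Y, tree]
    simp only [prec, this, if_true]
    exact mulCoeff_one_left b f
  · simp only [prec, Y, tree, node.injEq, h, false_and, and_false, if_false]
    exact mulCoeff_zero_left b f

/-- The coefficient of `Y ↶ z` at `a △ b` only involves those of `z` at `a` and `b`, so `z` vanishes
by induction on the tree. -/
theorem eq_zero_of_add_prelieₗ_Y {z : DendU K} (h0 : z nil = 0) (h : z + prelieₗ Y z = 0) :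
    z = 0 := by
  ext t
  induction t with
  | nil => exact h0
  | node _ a b iha ihb =>
    rw [eq_neg_of_add_eq_zero_left h, neg_apply, prelieₗ_apply, sub_apply, succ_Y_node,
      prec_Y_node, iha, ihb]
    simp

/-- Each added inner vertex changes the sign. For `u = 1 - suspension L` this reads `u ≻ Y = 1 - u`,
the form used from here on. -/
theorem suspension_L_eq : (suspension L : DendU K) = succ (1 - suspension L) Y := by
  have one_apply : ∀ t : PBTree, (1 : DendU K) t = if t = nil then 1 else 0 := fun _ => rfl
  ext t
  cases t with
  | nil => simp [suspension, L]
  | node c a b =>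
    have hL : (L : DendU K) (node c a b) = if b = nil then (1 + L : DendU K) a else 0 := by
      conv_lhs => rw [L_eq]
      exact succ_Y_node _ _ _
    refine (congrArg _ hL).trans ?_
    rw [succ_Y_node]
    by_cases hb : b = nil
    · subst hb
      by_cases ha : a = nil
      · subst ha
        simp [suspension, one_apply, L, numNodes]
      · simp only [if_true, add_apply, sub_apply, one_apply, ha, if_false, suspension, numNodes]
        ring
    · simp [hb]

variable {F u : DendU K}

/-- Since `(u ≻ Y) ≺ (F - 1) = u ≻ (Y ≺ (F - 1))`, the terms `u ≻ (F - 1)` cancel in `(1 - u) * (F -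
1)`, leaving `(F - 1) - (1 - u)`. -/
theorem comb_mul_comb (hF : prec Y F = F - 1) (hu : succ u Y = 1 - u) : u * F = 1 := by
  have hY : (Y : DendU K) nil = 0 := mem_filt_one.1 Y_mem_filt
  have hw : (F - 1) nil = 0 := by rw [← hF]; rfl
  have h1 : succ (1 - u) (F - 1) = F - 1 - succ u (F - 1) := by rw [sub_succ, one_succ hw]
  have h2 : prec (1 - u) (F - 1) = succ u (F - 1) - (1 - u) := by
    rw [← hu, succ_prec, prec_sub, hF, prec_one hY, succ_sub]
  have h3 : (1 - u) * (F - 1) = F - 1 - (1 - u) := by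
    rw [mul_eq_succ_add_prec' _ _ hw, h1, h2]
    abel
  linear_combination (norm := noncomm_ring) -h3

/-- In this order nothing cancels directly; instead `z = F * u - 1` satisfies `z + Y ↶ z = 0`. -/
theorem comb_mul_comb' (hF : prec Y F = F - 1) (hu : succ u Y = 1 - u) : F * u = 1 := by
  have hY : (Y : DendU K) nil = 0 := mem_filt_one.1 Y_mem_filt
  have hv : (1 - u) nil = 0 := by rw [← hu]; rfl
  have hw : (F - 1) nil = 0 := by rw [← hF]; rfl
  have h1 : succ (F - 1) (1 - u) = succ ((F - 1) * u) Y := by rw [← hu, succ_succ]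
  have h2 : prec (F - 1) (1 - u) = prec Y (F * (1 - u)) := by rw [← hF, prec_prec]
  have h3 := mul_eq_succ_add_prec' (F - 1) (1 - u) hv
  have h4 : F * u - 1 = (F - 1) - (1 - u) - (F - 1) * (1 - u) := by noncomm_ring
  refine sub_eq_zero.1 (eq_zero_of_add_prelieₗ_Y ?_ ?_)
  · rw [h4, h3, sub_apply, sub_apply, add_apply, hv, hw, succ_nil, prec_nil, add_zero, sub_zero,
      sub_zero]
  · rw [prelieₗ_apply, sub_succ, prec_sub, one_succ hY, prec_one hY, h4, h3, h1, h2, sub_mul,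
      one_mul, sub_succ, hu, mul_sub, mul_one, prec_sub, hF]
    abel

/-- Put `W = F * Z * u`. Expanding `(F - 1) * (Z * u)` with `F - 1 = Y ≺ F` gives `W = F ≻ (Z * u) +
Y ≺ W`. Expanding `Z * (1 - u)` with `1 - u = u ≻ Y` gives `Z * u = Z ≺ u - (Z * u) ≻ Y`, to which
`F ≻ ·` is applied. -/
theorem conj_add_prelieₗ_Y (hF : prec Y F = F - 1) (hu : succ u Y = 1 - u) {Z : DendU K}
    (hZ : Z nil = 0) :
    F * Z * u + prelieₗ Y (F * Z * u) = prec (succ F Z) u := by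
  have hZu : (Z * u) nil = 0 := by simp [mul_apply, mulCoeff, hZ]
  have h1 : F * Z * u = succ F (Z * u) + prec Y (F * Z * u) := by
    have := mul_eq_succ_add_prec' (F - 1) (Z * u) hZu
    rw [sub_succ, one_succ hZu, sub_mul, one_mul] at this
    rw [mul_assoc, ← prec_prec, hF]
    rw [sub_eq_iff_eq_add] at this
    rw [this]
    abel
  have h2 : Z * u = prec Z u - succ (Z * u) Y := by
    have h := mul_eq_succ_add_prec Z (1 - u) hZ
    rw [show succ Z (1 - u) = succ (Z * u) Y by rw [← hu, succ_succ], prec_sub, prec_one hZ,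
      mul_sub, mul_one] at h
    linear_combination (norm := abel) -h
  have h3 : succ F (Z * u) = prec (succ F Z) u - succ (F * Z * u) Y := by
    rw [succ_prec, mul_assoc, ← succ_succ, ← succ_sub, ← h2]
  rw [prelieₗ_apply]
  linear_combination (norm := abel) h1 + h3

end Comb

end DendU

/-! ### The `q`-shift and homogeneity of the images of trees -/

namespace DendU

open BinaryTree

variable {K : Type*} [CommRing K]

/-- Multiplicativity at `t` is a hypothesis so that this serves both inside the induction for the
product and afterwards for `≺` and `≻`. -/
theorem mulCoeff_pow_mul_aux (q : K) (t a b : PBTree) (f g : PBTree → K)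
    (ih : ∀ f g : PBTree → K, mulCoeff t (fun x => q ^ x.numNodes * f x)
      (fun x => q ^ x.numNodes * g x) = q ^ t.numNodes * mulCoeff t f g) :
    mulCoeff t (fun x => q ^ (node () a x).numNodes * f (node () a x))
        (fun x => q ^ x.numNodes * g x) =
      q ^ (a.numNodes + t.numNodes + 1) * mulCoeff t (fun x => f (node () a x)) g ∧
    mulCoeff t (fun x => q ^ x.numNodes * f x)
        (fun x => q ^ (node () x b).numNodes * g (node () x b)) =
      q ^ (t.numNodes + b.numNodes + 1) * mulCoeff t f (fun x => g (node () x b)) := by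
  have h1 : (fun x => q ^ (node () a x).numNodes * f (node () a x)) =
      fun x => q ^ (a.numNodes + 1) * (q ^ x.numNodes * f (node () a x)) := by
    funext x
    simp only [numNodes]
    ring
  have h2 : (fun x => q ^ (node () x b).numNodes * g (node () x b)) =
      fun x => q ^ (b.numNodes + 1) * (q ^ x.numNodes * g (node () x b)) := by
    funext x
    simp only [numNodes]
    ring
  rw [h1, h2, mulCoeff_smul_left, mulCoeff_smul_right, ih, ih]
  constructor <;> ring

theorem mulCoeff_pow_mul (q : K) (t : PBTree) (f g : PBTree → K) :
    mulCoeff t (fun x => q ^ x.numNodes * f x) (fun x => q ^ x.numNodes * g x) =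
      q ^ t.numNodes * mulCoeff t f g := by
  induction t generalizing f g with
  | nil => simp [mulCoeff, numNodes]
  | node _ a b iha ihb =>
    rw [mulCoeff, mulCoeff, (mulCoeff_pow_mul_aux q b a b f g ihb).1,
      (mulCoeff_pow_mul_aux q a a b f g iha).2, numNodes, mul_add]

theorem qShift_prec (q : K) (f g : DendU K) :
    qShift q (prec f g) = prec (qShift q f) (qShift q g) := by
  ext t
  cases t with
  | nil => exact mul_zero (q ^ 0)
  | node _ a b => exact (mulCoeff_pow_mul_aux q b a b f g (mulCoeff_pow_mul q b)).1.symm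

theorem qShift_succ (q : K) (f g : DendU K) :
    qShift q (succ f g) = succ (qShift q f) (qShift q g) := by
  ext t
  cases t with
  | nil => exact mul_zero (q ^ 0)
  | node _ a b => exact (mulCoeff_pow_mul_aux q a a b f g (mulCoeff_pow_mul q a)).2.symm

/-- The `q`-shift as a linear map. -/
def qShiftₗ (q : K) : DendU K →ₗ[K] DendU K where
  toFun := qShift q
  map_add' _ _ := ext fun _ => mul_add _ _ _
  map_smul' _ _ := ext fun _ => mul_left_comm _ _ _

theorem qShift_prelieₗ (q : K) (f g : DendU K) :
    qShift q (prelieₗ f g) = prelieₗ (qShift q f) (qShift q g) := by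
  rw [prelieₗ_apply, prelieₗ_apply, ← qShift_succ, ← qShift_prec]
  exact map_sub (qShiftₗ q) _ _

theorem qShift_mem_filt (q : K) {n : ℕ} {f : DendU K} (hf : f ∈ filt n) : qShift q f ∈ filt n :=
  fun t ht => by rw [qShift, hf t ht, mul_zero]

/-- Homogeneity of the image, propagated by `graft_induction`; `ofRTree_mem_filt` only bounds the
degree from below. -/
theorem qShift_ofRTree (q : K) (T : RTree) :
    qShift q (ofRTree T) = q ^ T.degree • ofRTree T := by
  induction T using RTree.graft_induction with
  | vertex =>
    ext t
    rw [ofRTree_vertex, qShift, smul_apply, Y, tree]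
    split_ifs with h
    · rw [h]; rfl
    · rw [mul_zero, mul_zero]
  | graft T S W hW hT hS ih =>
    have h := sum_map_ofRTree_graft (K := K) T S
    rw [hW, Multiset.map_cons, Multiset.sum_cons, ← eq_sub_iff_add_eq] at h
    have hsum : qShiftₗ q (W.map ofRTree).sum =
        q ^ (T.degree + S.degree) • (W.map ofRTree).sum := by
      rw [map_multiset_sum, Multiset.map_map, Multiset.smul_sum, Multiset.map_map]
      refine congrArg _ (Multiset.map_congr rfl fun U hU => ?_)
      rw [← RTree.degree_of_mem_graft (hW ▸ Multiset.mem_cons_of_mem hU)]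
      exact ih U hU
    rw [h]
    change qShiftₗ q _ = _
    rw [map_sub, hsum, RTree.degree_attach, smul_sub]
    congr 1
    refine (qShift_prelieₗ q _ _).trans ?_
    rw [hT, hS, map_smul, LinearMap.map_smul₂, smul_smul, pow_add, mul_comm]

end DendU

/-! ### Transport of the `q`-shift, the action and the linear trees by `φ` -/

section PhiHat

variable {K : Type*} [CommRing K]

theorem phiHat_qShift (q : K) (A : PLHat K) :
    (phiHat K (PLHat.qShift q A) : DendU K) = DendU.qShift q (phiHat K A) := by
  ext t
  rw [DendU.qShift, phiHat_apply, phiHat_apply, Finset.mul_sum]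
  refine Finset.sum_congr rfl fun T _ => ?_
  have := congrFun (DendU.qShift_ofRTree q T) t
  rw [DendU.qShift, DendU.smul_apply] at this
  rw [PLHat.qShift, mul_left_comm, this]
  ring

theorem phiHat_rightMul (A B : PLHat K) (k : ℕ) : (phiHat K (PLHat.rightMul B k A) : DendU K) =
    ((DendU.prelieₗ.flip (phiHat K B : DendU K) : Module.End K (DendU K)) ^ k) (phiHat K A) := by
  induction k with
  | zero => rfl
  | succ k ih =>
    rw [PLHat.rightMul, phiHat_prelie, ih, pow_succ']
    rfl

theorem hasSeries_phiHat_act (f : K⟦X⟧) (A B : PLHat K) :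
    DendU.HasSeries (fun k => PowerSeries.coeff k f •
      ((DendU.prelieₗ.flip (phiHat K B : DendU K) : Module.End K (DendU K)) ^ k) (phiHat K A))
      (phiHat K (PLHat.act f A B)) := by
  intro n
  have := phiHat_mem_filt (PLHat.act_sub_sum_mem_filt f A B n)
  simpa only [map_sub, map_sum, map_smul, Submodule.coe_sub, Submodule.coe_sum, Submodule.coe_smul,
    phiHat_rightMul] using this

theorem ofRTree_linear_succ (k : ℕ) : DendU.ofRTree (K := K) (RTree.linear (k + 1)) =
    DendU.prelieₗ DendU.Y (DendU.ofRTree (RTree.linear k)) := by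
  have := DendU.sum_map_ofRTree_graft (K := K) RTree.vertex (RTree.linear k)
  rwa [RTree.graft_vertex, Multiset.map_singleton, Multiset.sum_singleton,
    DendU.ofRTree_vertex] at this

theorem hasSeries_altLinearImage :
    DendU.HasSeries (fun k => (-1 : K) ^ k • DendU.ofRTree (RTree.linear k))
      (altLinearImage (phiHat K)) := by
  intro n t ht
  rw [DendU.sub_apply, DendU.sum_apply, sub_eq_zero, altLinearImage]
  simp only [phiHat_tree, DendU.smul_apply]
  refine finsum_eq_sum_of_support_subset _ fun k hk => ?_
  rw [Finset.mem_coe, Finset.mem_range]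
  by_contra hn
  refine hk ?_
  simp only
  rw [DendU.ofRTree_mem_filt (RTree.linear k) t (by rw [RTree.degree_linear]; omega), mul_zero]

/-- Linear trees satisfy `Lnr_{ℓ+1} = • ↶ Lnr_ℓ`, so the alternating sum of their images is the
geometric series for `(1 + Y ↶ ·)⁻¹` applied to `Y`. -/
theorem altLinearImage_add_prelieₗ :
    altLinearImage (phiHat K) + DendU.prelieₗ DendU.Y (altLinearImage (phiHat K)) = DendU.Y := by
  have h := hasSeries_altLinearImage.add_apply_eq (K := K) (D := DendU.prelieₗ DendU.Y)
    (fun n f hf => DendU.filt_anti (Nat.le_add_left n 1)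
      (DendU.prelieₗ_mem_filt DendU.Y_mem_filt hf)) fun k => by
        rw [ofRTree_linear_succ, map_smul, pow_succ, mul_neg_one, neg_smul]
  rw [h, pow_zero, one_smul]
  exact DendU.ofRTree_vertex

theorem phiHat_mem_filt_one (A : PLHat K) : (phiHat K A : DendU K) ∈ DendU.filt 1 :=
  phiHat_mem_filt (PLHat.mem_filt_one A)

theorem DendU.pow_mem_filt {ω : DendU K} (hω : ω ∈ DendU.filt 1) (m : ℕ) :
    ω ^ m ∈ DendU.filt m := by
  induction m with
  | zero => exact DendU.mem_filt_zero _
  | succ m ih =>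
    rw [pow_succ]
    exact DendU.mul_mem_filt ih hω

end PhiHat

theorem PLHat.act_exp_eq {K : Type*} [CommRing K] [Algebra ℚ K] (A B : PLHat K) :
    PLHat.act (PowerSeries.exp K) A B = PLHat.act (PowerSeries.exp K - 1) A B + A := by
  funext T
  rw [Pi.add_apply, act_eq_sum, act_eq_sum, ← sub_eq_iff_eq_add', ← Finset.sum_sub_distrib,
    Finset.sum_eq_single 0]
  · simp [rightMul]
  · intro k _ hk
    simp [PowerSeries.coeff_one, hk]
  · intro h
    exact absurd (Finset.mem_range.2 T.degree_pos) h

/-! ### The exponential of the image of `Ω` -/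

section Omega

variable {K : Type*} [Field K]

/-- The power series `(exp x - 1) / x`. -/
def expSubOneDivX (K : Type*) [Field K] : K⟦X⟧ := PowerSeries.mk fun k => (((k + 1)! : ℕ) : K)⁻¹

theorem coeff_expSubOneDivX (k : ℕ) :
    PowerSeries.coeff k (expSubOneDivX K) = (((k + 1)! : ℕ) : K)⁻¹ :=
  PowerSeries.coeff_mk _ _

variable [Algebra ℚ K]

theorem expSubOneDivX_mul_bernoulli : expSubOneDivX K * bernoulliPowerSeries K = 1 := by
  have h : PowerSeries.exp K - 1 = expSubOneDivX K * PowerSeries.X := by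
    ext n
    cases n with
    | zero => simp
    | succ n =>
      simp [PowerSeries.coeff_succ_mul_X, expSubOneDivX, PowerSeries.coeff_exp,
        PowerSeries.coeff_one]
  have h2 := bernoulliPowerSeries_mul_exp_sub_one K
  rw [h, ← mul_assoc] at h2
  have h3 := mul_right_cancel₀ PowerSeries.X_ne_zero (h2.trans (one_mul _).symm)
  rw [mul_comm, h3]

/-- The image `Ω'` of `Ω` over a field extension of `ℚ` solves the same equation. -/
theorem act_bernoulli_map {Ω : PLHat ℚ} (hΩ : IsOmega Ω) :
    PLHat.act (bernoulliPowerSeries K) (PLHat.tree RTree.vertex) (fun T => algebraMap ℚ K (Ω T)) =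
      fun T => algebraMap ℚ K (Ω T) := by
  have h := PLHat.map_act (algebraMap ℚ K) (bernoulliPowerSeries ℚ) (PLHat.tree RTree.vertex) Ω
  rw [hΩ, PLHat.map_tree] at h
  refine Eq.trans ?_ h.symm
  congr 1

variable [CharZero K]

/-- The action of `exp B` corresponds to the conjugation `a ↦ F ≻ a ≺ F⁻¹` by the exponential `F`
of the image of `B`. -/
theorem phiHat_act_exp_prec {A B : PLHat K} {F : DendU K}
    (hF : DendU.HasSeries (fun m => ((m ! : ℕ) : K)⁻¹ • (phiHat K B : DendU K) ^ m) F) :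
    DendU.prec (phiHat K (PLHat.act (PowerSeries.exp K) A B)) F =
      DendU.succ F (phiHat K A : DendU K) := by
  refine DendU.prec_exp_eq hF (phiHat_mem_filt_one B) (phiHat_mem_filt_one A) ?_
  have hc : ∀ k, PowerSeries.coeff k (PowerSeries.exp K) = ((k ! : ℕ) : K)⁻¹ := fun k => by
    simp [PowerSeries.coeff_exp]
  simpa only [hc] using hasSeries_phiHat_act (PowerSeries.exp K) A B

/-- If `B` solves the equation of `Ω`, the exponential of its image solves the equation
`F = 1 + Y ≺ F` of the right combs. -/
theorem Y_prec_exp_eq {B : PLHat K}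
    (hB : PLHat.act (bernoulliPowerSeries K) (PLHat.tree RTree.vertex) B = B) {F : DendU K}
    (hF : DendU.HasSeries (fun m => ((m ! : ℕ) : K)⁻¹ • (phiHat K B : DendU K) ^ m) F) :
    DendU.prec DendU.Y F = F - 1 := by
  refine DendU.prec_exp_eq_sub_one hF (phiHat_mem_filt_one B) ?_
  have h1 := hasSeries_phiHat_act (bernoulliPowerSeries K) (PLHat.tree RTree.vertex) B
  rw [hB, phiHat_tree, DendU.ofRTree_vertex] at h1
  have hD : ∀ n f, f ∈ DendU.filt n →
      (DendU.prelieₗ.flip (phiHat K B : DendU K) : Module.End K (DendU K)) f ∈ DendU.filt (n + 1) :=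
    fun n f hf => DendU.prelieₗ_mem_filt hf (phiHat_mem_filt_one B)
  -- `h1` expresses `ω` as `D / (exp D - 1)` applied to `Y`; this recovers `Y` as `(exp D - 1) / D`
  -- applied to `ω`.
  have h2 := h1.inverse hD expSubOneDivX_mul_bernoulli
  simp only [coeff_expSubOneDivX] at h2
  exact h2

/-- The exponential `F` of the image of `Ω`, with the equation of the right combs and the
description of the action of `exp Ω`. -/
theorem exists_exp_phiHat_omega {Ω : PLHat ℚ} (hΩ : IsOmega Ω) :
    ∃ F : DendU K, DendU.prec DendU.Y F = F - 1 ∧ ∀ A : PLHat K,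
      DendU.prec (phiHat K (PLHat.act (PowerSeries.exp K) A fun T => algebraMap ℚ K (Ω T))) F =
        DendU.succ F (phiHat K A : DendU K) := by
  obtain ⟨F, hF⟩ := DendU.exists_hasSeries fun m => Submodule.smul_mem _ ((m ! : ℕ) : K)⁻¹
    (DendU.pow_mem_filt (phiHat_mem_filt_one fun T => algebraMap ℚ K (Ω T)) m)
  exact ⟨F, Y_prec_exp_eq (act_bernoulli_map hΩ) hF, fun A => phiHat_act_exp_prec hF⟩

end Omega

/-! ### The `q`-equation and its unique solution -/

open DendU in
theorem eq_zero_of_conj_qShift {F u d : DendU (RatFunc ℚ)} (hF : F - 1 ∈ filt 1)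
    (hu : u - 1 ∈ filt 1) (h0 : d ∈ filt 1) (h : d = F * qShift qVar d * u) : d = 0 := by
  refine eq_of_forall_sub_mem_filt fun n => ?_
  rw [sub_zero]
  refine filt_anti n.le_succ ?_
  induction n with
  | zero => exact h0
  | succ n ih =>
    -- As `F` and `u` are `1` up to positive degree, the terms of degree `n + 1` of `d` and `d[q]`
    -- agree, and `q ^ (n + 1) ≠ 1`.
    have hq : qShift qVar d ∈ filt (n + 1) := qShift_mem_filt _ ih
    have h1 : d - qShift qVar d ∈ filt (n + 1 + 1) := by
      have : d - qShift qVar d = (F - 1) * (qShift qVar d * u) + qShift qVar d * (u - 1) := by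
        linear_combination (norm := noncomm_ring) h
      rw [this]
      refine add_mem ?_ (mul_mem_filt hq hu)
      have := mul_mem_filt hF (mul_mem_filt hq (mem_filt_zero u))
      rwa [add_comm, add_zero] at this
    intro t ht
    have h2 := h1 t ht
    rw [DendU.sub_apply, qShift, ← one_sub_mul, mul_eq_zero] at h2
    rcases h2 with h2 | h2
    · refine ih t (by_contra fun hn => ?_)
      exact qVar_pow_sub_one_ne_zero (n := t.numNodes) (by omega) (by rw [← neg_sub, h2, neg_zero])
    · exact h2

open DendU in
/-- The image of `Ω_q` is the only solution of the equation `X = F * X[q] * u + (1 - q) Λ`. -/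
theorem eq_conj_qShift_iff {Ω : PLHat ℚ} {F u : DendU (RatFunc ℚ)} (hF : prec Y F = F - 1)
    (hu : succ u Y = 1 - u)
    (hexp : ∀ A : PLHat (RatFunc ℚ), prec (phiHat (RatFunc ℚ) (PLHat.act
      (PowerSeries.exp (RatFunc ℚ)) A fun T => algebraMap ℚ (RatFunc ℚ) (Ω T))) F =
        succ F (phiHat (RatFunc ℚ) A : DendU (RatFunc ℚ)))
    {Ωq : PLHat (RatFunc ℚ)} (hq : IsOmegaQ Ω Ωq) (X : DendHat (RatFunc ℚ)) :
    (X : DendU (RatFunc ℚ)) =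
        F * qShift qVar X * u + (1 - qVar) • altLinearImage (phiHat (RatFunc ℚ)) ↔
      X = phiHat (RatFunc ℚ) Ωq := by
  have hFu : F * u = 1 := comb_mul_comb' hF hu
  set Λ := altLinearImage (phiHat (RatFunc ℚ)) with hΛ
  set x : DendU (RatFunc ℚ) :=
    ((phiHat (RatFunc ℚ) Ωq : DendHat (RatFunc ℚ)) : DendU (RatFunc ℚ)) with hx
  have hx0 : x BinaryTree.nil = 0 := (phiHat (RatFunc ℚ) Ωq).2
  have hΛ1 : Λ + prelieₗ Y Λ = Y := altLinearImage_add_prelieₗ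
  have hqx0 : qShift qVar x BinaryTree.nil = 0 := by rw [qShift, hx0, mul_zero]
  have key : x = F * qShift qVar x * u + (1 - qVar) • Λ := by
    have h1 := hexp (PLHat.qShift qVar Ωq)
    rw [PLHat.act_exp_eq] at h1
    have h2 : PLHat.act (PowerSeries.exp (RatFunc ℚ) - 1) (PLHat.qShift qVar Ωq)
        (fun T => algebraMap ℚ (RatFunc ℚ) (Ω T)) + PLHat.qShift qVar Ωq =
        PLHat.prelie (PLHat.tree RTree.vertex) Ωq + (qVar - 1) • PLHat.tree RTree.vertex + Ωq :=
      sub_eq_iff_eq_add.1 hq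
    rw [h2, phiHat_qShift, map_add, map_add, map_smul, Submodule.coe_add, Submodule.coe_add,
      Submodule.coe_smul, phiHat_prelie, phiHat_tree, ofRTree_vertex, ← hx] at h1
    have h3 := conj_add_prelieₗ_Y hF hu hqx0
    -- `h1` writes `F ≻ x[q]` as `(x + Y ↶ x + (q - 1) Y) ≺ F`; the outer `≺ u` then cancels `≺ F`
    -- because `F * u = 1`.
    rw [← h1, prec_prec, hFu, prec_one ?_] at h3
    -- By `h3` and `hΛ1` both sides of the goal have the same image under the injective map `z ↦ z +
    -- Y ↶ z`.
    · refine sub_eq_zero.1 (eq_zero_of_add_prelieₗ_Y ?_ ?_)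
      · have hW : (F * qShift qVar x * u) BinaryTree.nil = 0 := by simp [mul_apply, mulCoeff, hqx0]
        have hΛ0 : Λ BinaryTree.nil = 0 := by
          simp [hΛ, altLinearImage, phiHat_tree]
        rw [DendU.sub_apply, DendU.add_apply, DendU.smul_apply, hW, hx0, hΛ0]
        simp
      · rw [map_sub, map_add, map_smul]
        have h4 : (1 - qVar) • Λ + (1 - qVar) • prelieₗ Y Λ = (1 - qVar) • Y := by
          rw [← smul_add, hΛ1]
        have h5 : (qVar - 1) • (Y : DendU (RatFunc ℚ)) = -((1 - qVar) • Y) := by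
          rw [← neg_smul, neg_sub]
        rw [h5] at h3
        linear_combination (norm := abel) -h3 - h4
    · rw [DendU.add_apply, DendU.add_apply, DendU.smul_apply, hx0]
      simp [prelieₗ_apply, Y, tree]
  constructor
  · intro hX
    refine Subtype.ext (sub_eq_zero.1 (eq_zero_of_conj_qShift (F := F) (u := u) ?_ ?_ ?_ ?_))
    · rw [← hF]; exact mem_filt_one.2 rfl
    · rw [← neg_sub, ← hu]; exact neg_mem (mem_filt_one.2 rfl)
    · exact mem_filt_one.2 (X - phiHat (RatFunc ℚ) Ωq).2
    · have : qShift qVar ((X : DendU (RatFunc ℚ)) - x) = qShift qVar X - qShift qVar x :=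
        map_sub (qShiftₗ qVar) _ _
      change (X : DendU (RatFunc ℚ)) - x = F * qShift qVar ((X : DendU (RatFunc ℚ)) - x) * u
      rw [this, mul_sub, sub_mul (F * _)]
      linear_combination (norm := abel) hX - key
  · rintro rfl
    exact key

end

theorem mainTheorem10 :
    (∃! Ω : PLHat ℚ, IsOmega Ω) ∧
    (∃! Φ : PLHat (RatFunc ℚ) →ₗ[RatFunc ℚ] DendHat (RatFunc ℚ), IsPhi Φ) ∧
    ∀ Ω : PLHat ℚ, IsOmega Ω →
      (∃! Ωq : PLHat (RatFunc ℚ), IsOmegaQ Ω Ωq) ∧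
      ∃ u : (DendU (RatFunc ℚ))ˣ,
        (u : DendU (RatFunc ℚ)) = 1 - DendU.suspension DendU.L ∧
        ∀ (Ωq : PLHat (RatFunc ℚ)) (Φ : PLHat (RatFunc ℚ) →ₗ[RatFunc ℚ] DendHat (RatFunc ℚ)),
          IsOmegaQ Ω Ωq → IsPhi Φ →
          ∀ X : DendHat (RatFunc ℚ),
            (X : DendU (RatFunc ℚ)) =
                (↑u⁻¹ : DendU (RatFunc ℚ)) * DendU.qShift qVar X * (u : DendU (RatFunc ℚ)) +
                  (1 - qVar) • altLinearImage Φ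
              ↔ X = Φ Ωq := by
  refine ⟨existsUnique_isOmega, existsUnique_isPhi, fun Ω hΩ => ⟨existsUnique_isOmegaQ Ω, ?_⟩⟩
  obtain ⟨F, hF, hexp⟩ := exists_exp_phiHat_omega (K := RatFunc ℚ) hΩ
  have hu : DendU.succ (1 - DendU.suspension DendU.L) DendU.Y =
      1 - (1 - DendU.suspension DendU.L : DendU (RatFunc ℚ)) := by
    rw [← DendU.suspension_L_eq, sub_sub_cancel]
  refine ⟨⟨1 - DendU.suspension DendU.L, F, DendU.comb_mul_comb hF hu,
    DendU.comb_mul_comb' hF hu⟩, rfl, fun Ωq Φ hq hΦ X => ?_⟩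
  rw [hΦ.eq_phiHat]
  exact eq_conj_qShift_iff hF hu hexp hq X
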